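/- \textbf{Setting.} Let $\mathcal H$ be the Butcher--Connes--Kreimer Hopf algebra: the free commutative $\mathbb R$-algebra on the non-empty unlabelled non-planar rooted trees, with unit the empty forest (= empty tree) $\emptyset$, counit $\varepsilon$ ($\varepsilon(\emptyset)=1$, $\varepsilon(\tau)=0$ for non-empty trees $\tau$), coproduct $\Delta(\tau)=\sum_c P_c(\tau)\otimes R_c(\tau)$ over the admissible cuts $c$ of the tree $\tau$ (the empty cut and the total cut included; $R_c(\tau)$ is the component of the root and $P_c(\tau)$ the forest of the remaining components), extended multiplicatively, and antipode $S(\tau)=\sum_{c\subseteq E}(-1)^{|c|+1}\tau^c$ over all sets $c$ of edges of $\tau=(V,E)$, where $\tau^c=(V,E\setminus c)$, extended multiplicatively. A character is an algebra homomorphism $\psi:\mathcal H\to\mathbb R$; characters form a group under $\varphi_1*\varphi_2=\mu_{\mathbb R}\circ(\varphi_1\otimes\varphi_2)\circ\Delta$ with identity $\varepsilon$. Write $|\tau|$ for the number of nodes of $\tau$, and let $\bar\psi$ be the character with $\bar\psi(\tau)=(-1)^{|\tau|}\psi(\tau)$. The character $\psi$ is \emph{odd} if $\bar\psi=\psi^{-1}$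 in this group. A (formal one-step) method $\Psi$ assigns to each $N\ge 0$ and each smooth vector field $f:\mathbb R^N\to\mathbb R^N$ a formal power series $\Psi_h=\Psi_{h,f}$ in $h$ whose coefficients are maps $\mathbb R^N\to\mathbb R^N$; such series are composed by formal Taylor expansion. The B-series method with character $\psi$ is $$\Psi_{h,f}(y)=B_h(\psi,y)=\sum_\tau \frac{h^{|\tau|}}{\sigma(\tau)}\,\psi(\tau)\,F(\tau)(y),$$ summed over all rooted trees including $\emptyset$, where $\sigma(\tau)$ is the order of the symmetry group of $\tau$ and $F(\tau)$ is the elementary differential: $F(\emptyset)(y)=y$ and $F([\tau_1,\dots,\tau_m])(y)=f^{(m)}(y)(F(\tau_1)(y),\dots,F(\tau_m)(y))$. The adjoint of a method $\Psi$ is $\Psi^*_h=\Psi_{-h}^{-1}$, the two-sided inverse for composition of $\Psi_{-h}$ (for all $N$ and $f$), and $\Psi$ is symmetric if $\Psi=\Psi^*$. \textbf{Theorem.} Let $\Psi$ be the B-series method with character $\psi$. Then $\Psi$ has exactly one adjoint method $\Psi^*$, and $\Psi^*$ is again a B-series method. If $\psi^*$ is a character whose B-series method is $\Psi^*$, then $$\psi^*(\tau)=(-1)^{|\tau|}\,\psi(S\tau)\qquad\text{for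 every rooted tree }\tau,$$ that is, $\psi^*=\overline{\psi\circ S}$ on $\mathcal H$. Consequently, $\Psi$ is symmetric if and only if $\psi$ is odd, and also if and only if $\psi(\tau)=(-1)^{|\tau|}\psi(S\tau)$ for every rooted tree $\tau$. -/

import Mathlib

open scoped TensorProduct ContDiff

noncomputable section

namespace BCK

/-! ### Non-planar rooted trees -/

/-- Finite multisets form a quotient of the polynomial functor `X ↦ Σ n, (Fin n → X)`. -/
instance multisetQPF : QPF Multiset where
  map := @Multiset.map
  P := ⟨ℕ, Fin⟩
  abs := fun p => Multiset.ofList (List.ofFn p.2)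
  repr := fun s => ⟨s.toList.length, s.toList.get⟩
  abs_repr := by
    intro α s
    have h : List.ofFn s.toList.get = s.toList := List.ofFn_get _
    exact (congrArg Multiset.ofList h).trans s.coe_toList
  abs_map := by
    rintro α β f ⟨n, v⟩
    simp [PFunctor.map, List.map_ofFn]

/-- Non-empty, unlabelled, non-planar rooted trees: the initial algebra of the finite multiset
functor, i.e. a tree is exactly the same thing as the finite multiset of the subtrees that are
attached to its root (see `RTree.node`, `RTree.children` and `RTree.ind`). -/
def RTree : Type := QPF.Fix Multiset

namespace RTree

/-- `node {τ₁, …, τₖ} = [τ₁, …, τₖ]`: join the roots of `τ₁, …, τₖ` to a new root. -/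
def node (s : Multiset RTree) : RTree := QPF.Fix.mk (F := Multiset) s

/-- The multiset of the subtrees attached to the root. -/
def children (t : RTree) : Multiset RTree := QPF.Fix.dest (F := Multiset) t

@[simp] theorem node_children (t : RTree) : node (children t) = t :=
  QPF.Fix.mk_dest (F := Multiset) t

@[simp] theorem children_node (s : Multiset RTree) : children (node s) = s :=
  QPF.Fix.dest_mk (F := Multiset) s

theorem node_injective : Function.Injective node :=
  Function.LeftInverse.injective children_node

/-- Structural induction on trees. -/
theorem ind {p : RTree → Prop} (h : ∀ s : Multiset RTree, (∀ t ∈ s, p t) → p (node s))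
    (t : RTree) : p t := by
  refine QPF.Fix.ind (F := Multiset) p ?_ t
  intro s hs
  refine h s ?_
  obtain ⟨u, hu⟩ := hs
  intro t ht
  have hu' : Multiset.map Subtype.val u = s := hu
  subst hu'
  obtain ⟨x, -, hx⟩ := Multiset.mem_map.1 ht
  exact hx ▸ x.2

/-- Recursion with values in the pairs (the tree itself, the value on it). -/
def paraAux {α : Type} (g : Multiset (RTree × α) → α) : RTree → RTree × α :=
  QPF.Fix.rec (F := Multiset) (fun s => (node (s.map Prod.fst), g s))

/-- Structural recursion on trees: `para g` is the function `φ` that satisfies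
`φ (node s) = g {(t, φ t) | t ∈ s}`, see `para_node`. -/
def para {α : Type} (g : Multiset (RTree × α) → α) (t : RTree) : α := (paraAux g t).2

theorem paraAux_node {α : Type} (g : Multiset (RTree × α) → α) (s : Multiset RTree) :
    paraAux g (node s) =
      (node ((s.map (paraAux g)).map Prod.fst), g (s.map (paraAux g))) :=
  QPF.Fix.rec_eq (F := Multiset)
    (fun s : Multiset (RTree × α) => (node (s.map Prod.fst), g s)) s

theorem paraAux_fst {α : Type} (g : Multiset (RTree × α) → α) (t : RTree) :
    (paraAux g t).1 = t := by
  induction t using RTree.ind with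
  | h s ih =>
    rw [paraAux_node]
    simp only [Multiset.map_map, Function.comp_apply]
    rw [Multiset.map_congr rfl ih, Multiset.map_id']

theorem para_node {α : Type} (g : Multiset (RTree × α) → α) (s : Multiset RTree) :
    para g (node s) = g (s.map fun t => (t, para g t)) := by
  rw [para, paraAux_node]
  refine congrArg g (Multiset.map_congr rfl fun t _ => ?_)
  exact Prod.ext (paraAux_fst g t) rfl

/-- `|τ|`, the number of nodes of `τ`. -/
def order : RTree → ℕ := para fun s => 1 + (s.map Prod.snd).sum

theorem order_node (s : Multiset RTree) : order (node s) = 1 + (s.map order).sum := by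
  rw [order, para_node, Multiset.map_map]
  rfl

open Classical in
/-- The symmetry coefficient `σ(τ)`, with
`σ([τ₁ ^ k₁, …, τₘ ^ kₘ]) = ∏ kᵢ! σ(τᵢ) ^ kᵢ` for distinct `τ₁, …, τₘ`. -/
def symmetryFactor : RTree → ℕ := para fun s =>
  (∏ t ∈ (s.map Prod.fst).toFinset, ((s.map Prod.fst).count t).factorial) * (s.map Prod.snd).prod

open Classical in
theorem symmetryFactor_node (s : Multiset RTree) :
    symmetryFactor (node s) = (∏ t ∈ s.toFinset, (s.count t).factorial) * (s.map symmetryFactor).prod := by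
  rw [symmetryFactor, para_node]
  simp only [Multiset.map_map, Function.comp_def, Multiset.map_id']

theorem order_pos (t : RTree) : 0 < order t := by
  rw [← node_children t, order_node]
  omega

theorem finite_order_le (n : ℕ) : {t : RTree | order t ≤ n}.Finite := by
  classical
  induction n with
  | zero =>
    refine Set.Finite.subset Set.finite_empty fun t ht => ?_
    have := order_pos t
    simp only [Set.mem_ofPred_eq] at ht
    omega
  | succ n ih =>
    have key : ∀ s : Multiset RTree, s.card ≤ (s.map order).sum := by
      intro s
      have h := Multiset.card_nsmul_le_sum (s := s.map order) (a := 1) (by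
        intro x hx
        obtain ⟨t, -, rfl⟩ := Multiset.mem_map.1 hx
        exact order_pos t)
      simpa using h
    have hfin : (⋃ k ∈ Finset.range (n + 1),
        (fun m : Sym RTree k => node m.1) '' (ih.toFinset.sym k : Set (Sym RTree k))).Finite :=
      Set.Finite.biUnion (Finset.finite_toSet _) fun k _ => (Finset.finite_toSet _).image _
    refine hfin.subset fun t ht => ?_
    obtain ⟨s, rfl⟩ : ∃ s, node s = t := ⟨children t, node_children t⟩
    simp only [Set.mem_ofPred_eq, order_node] at ht
    simp only [Set.mem_iUnion]
    refine ⟨s.card, Finset.mem_range.2 ?_, ⟨s, rfl⟩, ?_, rfl⟩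
    · have := key s
      omega
    · refine Finset.mem_coe.2 (Finset.mem_sym_iff.2 ?_)
      intro t hts
      have hts' : t ∈ s := hts
      have h1 : order t ≤ (s.map order).sum :=
        Multiset.single_le_sum (fun _ _ => Nat.zero_le _) _ (Multiset.mem_map_of_mem _ hts')
      rw [Set.Finite.mem_toFinset, Set.mem_ofPred_eq]
      omega

theorem finite_order_eq (n : ℕ) : {t : RTree | order t = n}.Finite :=
  (finite_order_le n).subset fun _ ht => le_of_eq ht

/-- The finite set of all trees with `n` nodes. -/
def ofOrder (n : ℕ) : Finset RTree := (finite_order_eq n).toFinset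

@[simp] theorem mem_ofOrder {n : ℕ} {t : RTree} : t ∈ ofOrder n ↔ order t = n := by
  simp [ofOrder]

/-- All cuts of a tree, i.e. all subsets `c` of its edge set, listed (with multiplicity, one entry
per subset of edges) as the pairs `(R_c(τ), P_c(τ))`: `R_c(τ)` is the connected component of the
root of `τ` once the edges in `c` are removed, and `P_c(τ)` is the multiset of the other connected
components. So `|c|` is the cardinality of `P_c(τ)`.

A cut of `node s` is an independent choice, for each subtree `t ∈ s`, of a cut of `t` and of whether
the edge from the root to `t` is removed; if it is not, the component of the root of `t` becomes a
subtree attached to the root of `R_c`, and if it is, that component becomes a member of `P_c`. -/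
def cuts : RTree → Multiset (RTree × Multiset RTree) := para fun s =>
  (Multiset.Sections (s.map fun tc =>
    tc.2.map (fun c => (({c.1} : Multiset RTree), c.2)) +
      tc.2.map (fun c => ((0 : Multiset RTree), {c.1} + c.2)))).map
    fun choice => (node (choice.map Prod.fst).sum, (choice.map Prod.snd).sum)

theorem cuts_node (s : Multiset RTree) :
    cuts (node s) =
      (Multiset.Sections (s.map fun t =>
        (cuts t).map (fun c => (({c.1} : Multiset RTree), c.2)) +
          (cuts t).map (fun c => ((0 : Multiset RTree), {c.1} + c.2)))).map
        fun choice => (node (choice.map Prod.fst).sum, (choice.map Prod.snd).sum) := by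
  rw [cuts, para_node, Multiset.map_map]
  rfl

/-- All admissible cuts of a tree other than the total cut, i.e. all sets of edges that meet every
path from the root at most once, again listed as the pairs `(R_c(τ), P_c(τ))`.

An admissible cut of `node s` is an independent choice, for each subtree `t ∈ s`, of either removing
the edge from the root to `t` and no edge of `t`, or keeping this edge and taking an admissible cut
of `t`. The empty cut is included. -/
def admCuts : RTree → Multiset (RTree × Multiset RTree) := para fun s =>
  (Multiset.Sections (s.map fun tc =>
    tc.2.map (fun c => (({c.1} : Multiset RTree), c.2)) +
      {((0 : Multiset RTree), ({tc.1} : Multiset RTree))})).map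
    fun choice => (node (choice.map Prod.fst).sum, (choice.map Prod.snd).sum)

theorem admCuts_node (s : Multiset RTree) :
    admCuts (node s) =
      (Multiset.Sections (s.map fun t =>
        (admCuts t).map (fun c => (({c.1} : Multiset RTree), c.2)) +
          {((0 : Multiset RTree), ({t} : Multiset RTree))})).map
        fun choice => (node (choice.map Prod.fst).sum, (choice.map Prod.snd).sum) := by
  rw [admCuts, para_node, Multiset.map_map]
  rfl

end RTree

/-! ### The Butcher–Connes–Kreimer Hopf algebra -/

/-- The underlying algebra: the free commutative `ℝ`-algebra on the non-empty rooted trees. Its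
monomials are the forests, and the empty forest (the empty tree) is the unit `1`. -/
abbrev H : Type := MvPolynomial RTree ℝ

/-- A tree as an element of `H`. -/
def tree (t : RTree) : H := MvPolynomial.X t

/-- The forest with the given trees, as an element of `H`. -/
def forest (s : Multiset RTree) : H := (s.map tree).prod

/-- The counit: `1` on the empty forest and `0` on all non-empty trees. -/
def counit : H →ₐ[ℝ] ℝ := MvPolynomial.aeval fun _ => 0

/-- The coproduct, `Δ(τ) = ∑ P_c(τ) ⊗ R_c(τ)` over the admissible cuts of the tree `τ`, of which the
total cut contributes `τ ⊗ 1`; it is extended to `H` as an algebra homomorphism. -/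
def coproduct : H →ₐ[ℝ] H ⊗[ℝ] H := MvPolynomial.aeval fun t =>
  tree t ⊗ₜ[ℝ] (1 : H) + (t.admCuts.map fun c => forest c.2 ⊗ₜ[ℝ] tree c.1).sum

/-- The antipode, `S(τ) = ∑ (-1) ^ (|c| + 1) τ^c` over all cuts `c ⊆ E` of the tree `τ`, where the
forest `τ^c = (V, E \ c)` consists of `R_c(τ)` and `P_c(τ)`; it is extended to `H` as an algebra
homomorphism. -/
def antipode : H →ₐ[ℝ] H := MvPolynomial.aeval fun t =>
  (t.cuts.map fun c => (-1 : H) ^ (c.2.card + 1) * (tree c.1 * forest c.2)).sum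

/-- The characters of `H`, i.e. the elements of the Butcher group. -/
abbrev Character : Type := H →ₐ[ℝ] ℝ

/-- The convolution product `μ ∘ (φ₁ ⊗ φ₂) ∘ Δ` of two characters. -/
def conv (φ₁ φ₂ : Character) : Character :=
  (Algebra.TensorProduct.lmul' ℝ).comp ((Algebra.TensorProduct.map φ₁ φ₂).comp coproduct)

/-- The canonical involution of `H`, with `τ ↦ (-1) ^ |τ| τ` for all trees (hence forests) `τ`. -/
def involution : H →ₐ[ℝ] H := MvPolynomial.aeval fun t => (-1 : H) ^ t.order * tree t

/-- The character `ζ̄`, with `ζ̄(τ) = (-1) ^ |τ| ζ(τ)`. -/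
def bar (ζ : Character) : Character := ζ.comp involution

/-- A character `ζ` is odd if `ζ̄` is the inverse of `ζ` for the convolution product. -/
def IsOdd (ζ : Character) : Prop := conv (bar ζ) ζ = counit ∧ conv ζ (bar ζ) = counit

/-! ### Formal one-step methods and B-series -/

/-- A formal power series `∑ hⁿ cₙ` in the step size `h` whose coefficients are maps
`ℝᴺ → ℝᴺ`. -/
abbrev FormalMap (N : ℕ) : Type := ℕ → (Fin N → ℝ) → (Fin N → ℝ)

namespace FormalMap

variable {N : ℕ}

/-- The identity map `y ↦ y`. -/
def id : FormalMap N := fun n y => if n = 0 then y else 0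

/-- Replace `h` by `-h`. -/
def neg (Ψ : FormalMap N) : FormalMap N := fun n y => (-1 : ℝ) ^ n • Ψ n y

/-- The coefficient of `hⁿ` in the formal Taylor expansion of `g(Ψ_h(y))` about `Ψ₀(y)`:
`∑ 1/m! g⁽ᵐ⁾(Ψ₀(y))(Ψ_{k₁}(y), …, Ψ_{kₘ}(y))`, summed over all `m` and all
`k₁, …, kₘ ≥ 1` with `k₁ + ⋯ + kₘ = n`. -/
def substCoeff (g : (Fin N → ℝ) → (Fin N → ℝ)) (Ψ : FormalMap N) (n : ℕ) (y : Fin N → ℝ) :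
    Fin N → ℝ :=
  ∑ c : Composition n, ((c.length.factorial : ℝ)⁻¹) •
    iteratedFDeriv ℝ c.length g (Ψ 0 y) (fun i => Ψ (c.blocksFun i) y)

/-- The composition `Φ_h ∘ Ψ_h` as a formal power series: `Φ_h(Ψ_h(y)) = ∑ hⁱ Φᵢ(Ψ_h(y))`. -/
def comp (Φ Ψ : FormalMap N) : FormalMap N := fun n y =>
  ∑ p ∈ Finset.HasAntidiagonal.antidiagonal n, substCoeff (Φ p.1) Ψ p.2 y

end FormalMap

/-- Smooth vector fields on `ℝᴺ`. -/
abbrev SmoothField (N : ℕ) : Type := {f : (Fin N → ℝ) → (Fin N → ℝ) // ContDiff ℝ ∞ f}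

/-- A formal one-step method: a formal power series in the step size for each smooth vector field
in each dimension. -/
abbrev Method : Type := ∀ N : ℕ, SmoothField N → FormalMap N

/-- The elementary differentials
`F([τ₁, …, τₘ])(y) = f⁽ᵐ⁾(y)(F(τ₁)(y), …, F(τₘ)(y))`. As the derivatives of a smooth `f`
are symmetric, the order in which the subtrees are listed does not matter, see
`elementaryDifferential_node`. -/
def elementaryDifferential {N : ℕ} (f : (Fin N → ℝ) → (Fin N → ℝ)) :
    RTree → (Fin N → ℝ) → (Fin N → ℝ) :=
  RTree.para fun s y =>
    iteratedFDeriv ℝ (s.map Prod.snd).toList.length f y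
      (fun i => (s.map Prod.snd).toList.get i y)

theorem iteratedFDeriv_perm {N : ℕ} {f : (Fin N → ℝ) → (Fin N → ℝ)} (hf : ContDiff ℝ ∞ f)
    {l l' : List (Fin N → ℝ)} (h : l.Perm l') (y : Fin N → ℝ) :
    iteratedFDeriv ℝ l.length f y l.get = iteratedFDeriv ℝ l'.length f y l'.get := by
  have smooth : ∀ l : List (Fin N → ℝ),
      ContDiff ℝ ∞ (fun z => iteratedFDeriv ℝ l.length f z l.get) := fun l =>
    (ContinuousMultilinearMap.apply ℝ (fun _ : Fin l.length => Fin N → ℝ) (Fin N → ℝ)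
      l.get).contDiff.comp
      (hf.iteratedFDeriv_right (m := ∞) (by norm_cast))
  have cons : ∀ (a : Fin N → ℝ) (l : List (Fin N → ℝ)) (z : Fin N → ℝ),
      iteratedFDeriv ℝ (a :: l).length f z (a :: l).get =
        fderiv ℝ (fun z => iteratedFDeriv ℝ l.length f z l.get) z a := by
    intro a l z
    have hd : DifferentiableAt ℝ (iteratedFDeriv ℝ l.length f) z :=
      (hf.differentiable_iteratedFDeriv (by exact_mod_cast WithTop.coe_lt_top _)) z
    rw [fderiv_continuousMultilinear_apply_const_apply hd]
    rfl
  induction h generalizing y with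
  | nil => rfl
  | cons a _ ih => rw [cons, cons, funext ih]
  | swap a b l =>
    have key : ∀ a b : Fin N → ℝ,
        iteratedFDeriv ℝ (a :: b :: l).length f y (a :: b :: l).get =
          fderiv ℝ (fderiv ℝ fun z => iteratedFDeriv ℝ l.length f z l.get) y a b := by
      intro a b
      have hd : DifferentiableAt ℝ
          (fderiv ℝ fun z => iteratedFDeriv ℝ l.length f z l.get) y :=
        ((smooth l).fderiv_right (m := 1) (by norm_cast)).differentiable (by simp) y
      rw [cons, funext (cons b l), fderiv_clm_apply hd (differentiableAt_const b)]
      simp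
    rw [key, key]
    exact ((smooth l).contDiffAt.isSymmSndFDerivAt (by
      simpa using (WithTop.coe_le_coe.2 (le_top : (2 : ℕ∞) ≤ ⊤)))).eq b a
  | trans _ _ ih₁ ih₂ => rw [ih₁, ih₂]

theorem elementaryDifferential_node {N : ℕ} {f : (Fin N → ℝ) → (Fin N → ℝ)}
    (hf : ContDiff ℝ ∞ f) (l : List RTree) (y : Fin N → ℝ) :
    elementaryDifferential f (RTree.node l) y =
      iteratedFDeriv ℝ l.length f y (fun i => elementaryDifferential f (l.get i) y) := by
  have get_map : ∀ {α : Type} (l : List α) (g : α → (Fin N → ℝ)),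
      iteratedFDeriv ℝ (l.map g).length f y (l.map g).get =
        iteratedFDeriv ℝ l.length f y (fun i => g (l.get i)) := by
    intro α l g
    have : ∀ (n : ℕ) (h : n = l.length) (v : Fin n → (Fin N → ℝ)),
        (∀ i, v i = g (l.get (Fin.cast h i))) →
        iteratedFDeriv ℝ n f y v = iteratedFDeriv ℝ l.length f y (fun i => g (l.get i)) := by
      rintro n rfl v hv
      exact congrArg _ (funext hv)
    exact this _ (by simp) _ (by simp)
  rw [elementaryDifferential, RTree.para_node, ← elementaryDifferential]
  refine (get_map (Multiset.toList _) (fun g : (Fin N → ℝ) → (Fin N → ℝ) => g y)).symm.trans (Eq.trans ?_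
    (get_map l fun t => elementaryDifferential f t y))
  refine iteratedFDeriv_perm hf ?_ y
  rw [← Multiset.coe_eq_coe, ← Multiset.map_coe, Multiset.coe_toList, Multiset.map_map,
    ← Multiset.map_coe, Multiset.map_map]
  rfl

/-- The B-series method of the character `φ`, i.e. the formal power series
`B_h(φ, y) = ∑ h ^ |τ| / σ(τ) φ(τ) F(τ)(y)` over all rooted trees `τ`. The coefficient of `h⁰`
is the contribution `φ(1) F(∅)(y) = y` of the empty tree. -/
def bSeries (φ : Character) : Method := fun _ f n y =>
  if n = 0 then y
  else ∑ t ∈ RTree.ofOrder n, (φ (tree t) / (t.symmetryFactor : ℝ)) • elementaryDifferential f.1 t y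

/-- `Φ` is the adjoint method of `Ψ`: `Φ_h = (Ψ_{-h})⁻¹`. -/
def IsAdjoint (Ψ Φ : Method) : Prop := ∀ (N : ℕ) (f : SmoothField N),
  (Φ N f).comp (Ψ N f).neg = FormalMap.id ∧ (Ψ N f).neg.comp (Φ N f) = FormalMap.id

/-- A method is symmetric if it is its own adjoint. -/
def IsSymmetric (Ψ : Method) : Prop := IsAdjoint Ψ Ψ

end BCK

end

/-!
The cuts of `[τ₁, …, τₘ]` other than the total one are independent choices of cuts of the `τᵢ`, so
`(φ ⊗ id) ∘ Δ ∘ B₊ = (φ ∘ B₊) · 1 + B₊ ∘ (φ ⊗ id) ∘ Δ`. By induction on trees, this cocycle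
identity makes convolution associative and `ψ ∘ S` the inverse of `ψ`.

Composition of B-series is convolution of characters. Modulo `h ^ (K + 1)`, the substitution `y ↦
∑ h^|τ| φ(τ) / σ(τ) F(τ)(y)` is the exponential of a first-order differential operator with
constant coefficients and nilpotent symbol. Expanding the exponential gives a sum over forests,
whose symmetry factors cancel against those of the derivations `σ(u) ∂/∂u` of `H`: these pair
forests with iterated derivatives. Induction on `u` then identifies the Taylor coefficients of
`F(u)` with the coefficients of `u` in `(φ ⊗ id) Δ τ`, that is, with the admissible cuts of `τ`
with trunk `u`.

The elementary differentials are separated at `0` by the vector field with one coordinate for each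
tree of bounded order whose component along `[τ₁, …, τₘ]` is the product of the coordinates of the
`τᵢ`. So a B-series method determines its character. Since `h ↦ -h` replaces `ψ` by `ψ̄`, the
adjoint is the B-series method of `ψ̄⁻¹`, and this is the character that is conjugate to `ψ ∘ S`
because `ψ ↦ ψ̄` is an endomorphism of the group.
-/

noncomputable section

namespace BCK

/-! ### The grafting operator -/

theorem sum_map_prod_sections {α R : Type*} [CommSemiring R] (S : Multiset (Multiset α))
    (w : α → R) :
    (S.Sections.map fun c => (c.map w).prod).sum = (S.map fun m => (m.map w).sum).prod := by
  induction S using Multiset.induction_on with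
  | empty => simp
  | cons m S ih =>
    rw [Multiset.sections_cons, Multiset.map_bind, Multiset.sum_bind, Multiset.map_cons,
      Multiset.prod_cons, ← ih, ← Multiset.sum_map_mul_right]
    refine congrArg Multiset.sum (Multiset.map_congr rfl fun a _ => ?_)
    simp [Multiset.map_map, Multiset.sum_map_mul_left]

@[simp] theorem forest_zero : forest 0 = 1 := by simp [forest]

@[simp] theorem forest_add (s t : Multiset RTree) : forest (s + t) = forest s * forest t := by
  simp [forest]

@[simp] theorem forest_cons (t : RTree) (s : Multiset RTree) :
    forest (t ::ₘ s) = tree t * forest s := by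
  simp [forest]

@[simp] theorem forest_singleton (t : RTree) : forest {t} = tree t := by simp [forest]

theorem forest_eq_monomial [DecidableEq RTree] (s : Multiset RTree) :
    forest s = MvPolynomial.monomial (Multiset.toFinsupp s) 1 := by
  induction s using Multiset.induction_on with
  | empty => simp
  | cons t s ih =>
    rw [forest_cons, ih, ← Multiset.singleton_add, map_add, tree, MvPolynomial.X,
      MvPolynomial.monomial_mul, Multiset.toFinsupp_singleton, one_mul]

theorem basisMonomials_toFinsupp [DecidableEq RTree] (s : Multiset RTree) :
    MvPolynomial.basisMonomials RTree ℝ (Multiset.toFinsupp s) = forest s := by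
  rw [forest_eq_monomial, MvPolynomial.coe_basisMonomials]

/-- The grafting operator `B₊`, which maps a forest `s` to the tree `node s`. -/
def graft : H →ₗ[ℝ] H :=
  (MvPolynomial.basisMonomials RTree ℝ).constr ℝ fun m => tree (RTree.node (Finsupp.toMultiset m))

@[simp] theorem graft_forest (s : Multiset RTree) : graft (forest s) = tree (RTree.node s) := by
  classical
  rw [graft, ← basisMonomials_toFinsupp, Module.Basis.constr_basis, Multiset.toFinsupp_toMultiset]

theorem algHom_ext_tree {R : Type*} [CommSemiring R] [Algebra ℝ R] {φ ψ : H →ₐ[ℝ] R}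
    (h : ∀ t, φ (tree t) = ψ (tree t)) : φ = ψ :=
  MvPolynomial.algHom_ext h

theorem linearMap_ext_forest {M : Type*} [AddCommMonoid M] [Module ℝ M] {f g : H →ₗ[ℝ] M}
    (h : ∀ s, f (forest s) = g (forest s)) : f = g :=
  (MvPolynomial.basisMonomials RTree ℝ).ext fun m => by
    classical
    rw [← Finsupp.toMultiset_toFinsupp m, basisMonomials_toFinsupp, h]

theorem algHom_forest {R : Type*} [CommSemiring R] [Algebra ℝ R] (φ : H →ₐ[ℝ] R)
    (s : Multiset RTree) : φ (forest s) = (s.map fun t => φ (tree t)).prod := by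
  rw [forest, map_multiset_prod, Multiset.map_map]
  rfl

theorem algHom_ext_graft {R : Type*} [CommSemiring R] [Algebra ℝ R] {φ ψ : H →ₐ[ℝ] R}
    (h : ∀ x, φ x = ψ x → φ (graft x) = ψ (graft x)) : φ = ψ := by
  refine algHom_ext_tree fun t => ?_
  induction t using RTree.ind with
  | h s ih =>
    rw [← graft_forest]
    exact h _ (by rw [algHom_forest, algHom_forest, Multiset.map_congr rfl ih])

@[simp] theorem algHom_C {R : Type*} [CommSemiring R] [Algebra ℝ R] (φ : H →ₐ[ℝ] R) (a : ℝ) :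
    φ (MvPolynomial.C a) = algebraMap ℝ R a :=
  φ.commutes a

theorem counit_graft (x : H) : counit (graft x) = 0 :=
  LinearMap.congr_fun (f := counit.toLinearMap ∘ₗ graft) (g := 0)
    (linearMap_ext_forest fun s => by simp [counit, tree]) x

/-! ### The Butcher group -/

/-- `(φ ⊗ id) ∘ Δ`. It encodes the convolution product with the left factor `φ`, see
`conv_eq_comp_translate`. -/
def translate (φ : Character) : H →ₐ[ℝ] H :=
  (Algebra.TensorProduct.lid ℝ H).toAlgHom.comp
    ((Algebra.TensorProduct.map φ (AlgHom.id ℝ H)).comp coproduct)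

/-- `∑ φ(P_c(τ)) R_c(τ)` over the admissible cuts other than the total cut. -/
def trunk (φ : Character) (t : RTree) : H :=
  (t.admCuts.map fun c => φ (forest c.2) • tree c.1).sum

theorem translate_tree (φ : Character) (t : RTree) :
    translate φ (tree t) = MvPolynomial.C (φ (tree t)) + trunk φ t := by
  have h : coproduct (tree t) = tree t ⊗ₜ[ℝ] (1 : H) +
      (t.admCuts.map fun c => forest c.2 ⊗ₜ[ℝ] tree c.1).sum := by
    simp [coproduct, tree]
  simp [translate, trunk, h, map_multiset_sum, Multiset.map_map, Function.comp_def,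
    MvPolynomial.C_eq_smul_one]

theorem conv_eq_comp_translate (φ₁ φ₂ : Character) : conv φ₁ φ₂ = φ₂.comp (translate φ₁) := by
  have h : (Algebra.TensorProduct.lmul' ℝ).comp (Algebra.TensorProduct.map φ₁ φ₂) =
      φ₂.comp ((Algebra.TensorProduct.lid ℝ H).toAlgHom.comp
        (Algebra.TensorProduct.map φ₁ (AlgHom.id ℝ H))) :=
    Algebra.TensorProduct.ext' fun x y => by simp
  rw [conv, ← AlgHom.comp_assoc, h]
  rfl

theorem conv_apply (φ₁ φ₂ : Character) (x : H) : conv φ₁ φ₂ x = φ₂ (translate φ₁ x) := by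
  rw [conv_eq_comp_translate, AlgHom.comp_apply]

/-- The cuts of `node s` are independent choices for the members of `s`, so that multiplicative
weights turn the sum over the cuts into a product. -/
theorem sum_choices (g : Multiset RTree → ℝ) (hg0 : g 0 = 1) (hg : ∀ a b, g (a + b) = g a * g b)
    (S : Multiset (Multiset (Multiset RTree × Multiset RTree))) :
    (S.Sections.map fun c => g (c.map Prod.snd).sum • tree (RTree.node (c.map Prod.fst).sum)).sum =
      graft (S.map fun m => (m.map fun p => g p.2 • forest p.1).sum).prod := by
  rw [← sum_map_prod_sections, map_multiset_sum, Multiset.map_map]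
  refine congrArg Multiset.sum (Multiset.map_congr rfl fun c _ => ?_)
  have hc : (c.map fun p => g p.2 • forest p.1).prod =
      g (c.map Prod.snd).sum • forest (c.map Prod.fst).sum := by
    clear * - hg0 hg
    induction c using Multiset.induction_on with
    | empty => simp [hg0]
    | cons a c ih => simp [ih, hg, smul_smul, mul_comm]
  simp only [Function.comp_apply, hc, map_smul, graft_forest]

theorem trunk_node (φ : Character) (s : Multiset RTree) :
    trunk φ (RTree.node s) = graft (translate φ (forest s)) := by
  rw [trunk, RTree.admCuts_node, Multiset.map_map]
  refine (sum_choices (fun a => φ (forest a)) (by simp) (by simp) _).trans ?_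
  rw [algHom_forest, Multiset.map_map]
  refine congrArg (fun x => graft (Multiset.prod x)) (Multiset.map_congr rfl fun t _ => ?_)
  simp [translate_tree, trunk, Multiset.map_map, add_comm, MvPolynomial.C_eq_smul_one]

theorem translate_graft (φ : Character) (x : H) :
    translate φ (graft x) = MvPolynomial.C (φ (graft x)) + graft (translate φ x) :=
  LinearMap.congr_fun
    (f := (translate φ).toLinearMap ∘ₗ graft)
    (g := Algebra.linearMap ℝ H ∘ₗ φ.toLinearMap ∘ₗ graft + graft ∘ₗ (translate φ).toLinearMap)
    (linearMap_ext_forest fun s => by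
      simp [translate_tree, trunk_node, MvPolynomial.algebraMap_eq]) x

theorem translate_conv (φ₁ φ₂ : Character) :
    translate (conv φ₁ φ₂) = (translate φ₂).comp (translate φ₁) :=
  algHom_ext_graft fun x hx => by
    simp only [AlgHom.comp_apply, translate_graft, map_add, algHom_C, hx, conv_apply,
      MvPolynomial.algebraMap_eq, Algebra.algebraMap_self_apply, add_assoc]

theorem conv_assoc (φ₁ φ₂ φ₃ : Character) :
    conv (conv φ₁ φ₂) φ₃ = conv φ₁ (conv φ₂ φ₃) := by
  simp only [conv_eq_comp_translate, ← translate_conv, AlgHom.comp_assoc]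

theorem translate_counit : translate counit = AlgHom.id ℝ H :=
  algHom_ext_graft fun x hx => by simp [translate_graft, counit_graft, hx]

theorem counit_conv (φ : Character) : conv counit φ = φ := by
  rw [conv_eq_comp_translate, translate_counit, AlgHom.comp_id]

/-- `∑ (-1) ^ |c| ψ(P_c(τ)) R_c(τ)` over all cuts of `τ`. -/
def signedTrunk (ψ : Character) (t : RTree) : H :=
  (t.cuts.map fun c => ((-1) ^ c.2.card * ψ (forest c.2)) • tree c.1).sum

theorem apply_antipode_tree (ψ : Character) (t : RTree) :
    ψ (antipode (tree t)) = -ψ (signedTrunk ψ t) := by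
  have h : antipode (tree t) =
      (t.cuts.map fun c => (-1 : H) ^ (c.2.card + 1) * (tree c.1 * forest c.2)).sum := by
    simp [antipode, tree]
  rw [h, signedTrunk, map_multiset_sum, map_multiset_sum, ← Multiset.sum_map_neg']
  simp only [Multiset.map_map, Function.comp_apply, map_mul, map_pow, map_neg, map_one, map_smul,
    smul_eq_mul]
  refine congrArg Multiset.sum (Multiset.map_congr rfl fun c _ => ?_)
  ring

theorem signedTrunk_node (ψ : Character) (s : Multiset RTree) :
    signedTrunk ψ (RTree.node s) = graft (s.map fun t =>
      MvPolynomial.C (ψ (antipode (tree t))) + signedTrunk ψ t).prod := by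
  rw [signedTrunk, RTree.cuts_node, Multiset.map_map]
  refine (sum_choices (fun a => (-1) ^ a.card * ψ (forest a)) (by simp)
    (fun a b => by simp [pow_add]; ring) _).trans ?_
  rw [Multiset.map_map]
  refine congrArg (fun x => graft (Multiset.prod x)) (Multiset.map_congr rfl fun t _ => ?_)
  have hcut : MvPolynomial.C (ψ (antipode (tree t))) =
      (t.cuts.map fun c =>
        ((-1) ^ (c.2.card + 1) * (ψ (tree c.1) * ψ (forest c.2))) • (1 : H)).sum := by
    rw [apply_antipode_tree, signedTrunk, map_multiset_sum, ← Multiset.sum_map_neg',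
      map_multiset_sum]
    simp only [Multiset.map_map, Function.comp_apply, map_smul, smul_eq_mul,
      ← MvPolynomial.C_eq_smul_one]
    refine congrArg Multiset.sum (Multiset.map_congr rfl fun c _ => congrArg _ ?_)
    ring
  rw [hcut, signedTrunk, add_comm]
  simp [Multiset.map_map]

theorem signedTrunk_eq_trunk (ψ : Character) (t : RTree) :
    signedTrunk ψ t = trunk (ψ.comp antipode) t := by
  induction t using RTree.ind with
  | h s ih =>
    rw [signedTrunk_node, trunk_node, algHom_forest]
    refine congrArg (fun x => graft (Multiset.prod x)) (Multiset.map_congr rfl fun t ht => ?_)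
    rw [translate_tree, ih t ht, AlgHom.comp_apply]

theorem conv_antipode_left (ψ : Character) : conv (ψ.comp antipode) ψ = counit := by
  refine algHom_ext_tree fun t => ?_
  rw [conv_apply, translate_tree, ← signedTrunk_eq_trunk, map_add, AlgHom.comp_apply, algHom_C,
    apply_antipode_tree]
  simp [counit, tree]

instance : Mul Character := ⟨conv⟩

instance : One Character := ⟨counit⟩

instance : Inv Character := ⟨fun ψ => ψ.comp antipode⟩

instance : Group Character := Group.ofLeftAxioms conv_assoc counit_conv conv_antipode_left

/-! ### The canonical involution -/

theorem involution_tree (t : RTree) : involution (tree t) = (-1 : ℝ) ^ t.order • tree t := by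
  simp [involution, tree, MvPolynomial.smul_eq_C_mul]

theorem bar_tree (ψ : Character) (t : RTree) :
    bar ψ (tree t) = (-1 : ℝ) ^ t.order * ψ (tree t) := by
  simp [bar, involution_tree]

theorem involution_forest (s : Multiset RTree) :
    involution (forest s) = (-1 : ℝ) ^ (s.map RTree.order).sum • forest s := by
  induction s using Multiset.induction_on with
  | empty => simp
  | cons t s ih => simp [ih, involution_tree, pow_add, smul_smul, mul_comm]

theorem involution_graft (x : H) : involution (graft x) = -graft (involution x) :=
  LinearMap.congr_fun (f := involution.toLinearMap ∘ₗ graft)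
    (g := -(graft ∘ₗ involution.toLinearMap))
    (linearMap_ext_forest fun s => by
      simp [involution_tree, involution_forest, RTree.order_node, pow_add]) x

theorem involution_comp_translate_bar (φ : Character) :
    involution.comp (translate (bar φ)) = (translate φ).comp involution :=
  algHom_ext_graft fun x hx => by
    have hx' : involution (translate (bar φ) x) = translate φ (involution x) := hx
    simp only [AlgHom.comp_apply, translate_graft, involution_graft, map_add, map_neg, algHom_C,
      bar, MvPolynomial.algebraMap_eq, neg_add]
    rw [← hx', bar]

theorem bar_counit : bar counit = counit :=
  algHom_ext_graft fun x _ => by simp [bar, involution_graft, counit_graft]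

theorem bar_conv (φ₁ φ₂ : Character) : bar (conv φ₁ φ₂) = conv (bar φ₁) (bar φ₂) := by
  rw [bar, conv_eq_comp_translate, conv_eq_comp_translate, AlgHom.comp_assoc,
    ← involution_comp_translate_bar]
  rfl

/-- `ζ ↦ ζ̄` as an endomorphism of the Butcher group. -/
def barHom : Character →* Character where
  toFun := bar
  map_one' := bar_counit
  map_mul' := bar_conv

theorem bar_comp_antipode (ψ : Character) : bar (ψ.comp antipode) = (bar ψ)⁻¹ :=
  map_inv barHom ψ

theorem isOdd_iff (ψ : Character) : IsOdd ψ ↔ bar ψ = ψ⁻¹ :=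
  ⟨fun h => eq_inv_of_mul_eq_one_left h.1, fun h => by
    rw [IsOdd, h]
    exact ⟨inv_mul_cancel ψ, mul_inv_cancel ψ⟩⟩

/-! ### Duality between forests and derivations -/

theorem symmetryFactor_cons [inst : DecidableEq RTree] (t : RTree) (s : Multiset RTree) :
    (RTree.node (t ::ₘ s)).symmetryFactor =
      (s.count t + 1) * t.symmetryFactor * (RTree.node s).symmetryFactor := by
  obtain rfl : inst = fun a b => Classical.propDecidable (a = b) :=
    Subsingleton.elim _ _
  classical
  have hs : ∏ r ∈ s.toFinset, (s.count r).factorial =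
      ∏ r ∈ (t ::ₘ s).toFinset, (s.count r).factorial :=
    Finset.prod_subset (Multiset.toFinset_subset.2 (Multiset.subset_cons s t)) fun r _ hr => by
      rw [Multiset.mem_toFinset] at hr
      simp [Multiset.count_eq_zero_of_notMem hr]
  have ht : t ∈ (t ::ₘ s).toFinset := by simp
  rw [RTree.symmetryFactor_node, RTree.symmetryFactor_node, hs, ← Finset.mul_prod_erase _ _ ht,
    ← Finset.mul_prod_erase _ _ ht, Multiset.count_cons_self, Nat.factorial_succ,
    Finset.prod_congr rfl fun r hr => by
      rw [Multiset.count_cons_of_ne (Finset.ne_of_mem_erase hr)],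
    Multiset.map_cons, Multiset.prod_cons]
  ring

@[simp] theorem symmetryFactor_node_zero : (RTree.node 0).symmetryFactor = 1 := by
  simp [RTree.symmetryFactor_node]

theorem symmetryFactor_ne_zero (t : RTree) : (t.symmetryFactor : ℝ) ≠ 0 := by
  classical
  induction t using RTree.ind with
  | h s ih =>
    induction s using Multiset.induction_on with
    | empty => simp
    | cons t s ihs =>
      rw [symmetryFactor_cons]
      push_cast
      exact mul_ne_zero (mul_ne_zero (Nat.cast_add_one_ne_zero _) (ih t (by simp)))
        (ihs fun r hr => ih r (Multiset.mem_cons_of_mem hr))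

theorem derivation_multiset_prod {R A ι : Type*} [CommSemiring R] [CommSemiring A] [Algebra R A]
    [DecidableEq ι] (D : Derivation R A A) (f : ι → A) (s : Multiset ι) :
    D (s.map f).prod = (s.map fun i => D (f i) * ((s.erase i).map f).prod).sum := by
  induction s using Multiset.induction_on with
  | empty => simp
  | cons a s ih =>
    rw [Multiset.map_cons, Multiset.prod_cons, D.leibniz, ih, Multiset.map_cons, Multiset.sum_cons,
      Multiset.erase_cons_head, add_comm, smul_eq_mul, smul_eq_mul, mul_comm,
      ← Multiset.sum_map_mul_left]
    refine congrArg (D (f a) * (s.map f).prod + Multiset.sum ·)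
      (Multiset.map_congr rfl fun i hi => ?_)
    rw [mul_left_comm, ← Multiset.prod_cons, ← Multiset.map_cons,
      Multiset.erase_cons_tail_of_mem hi]

theorem algHom_derivation_comm {σ R A : Type*} [CommSemiring R] [CommSemiring A] [Algebra R A]
    {D : Derivation R (MvPolynomial σ R) (MvPolynomial σ R)} {E : Derivation R A A}
    (κ : MvPolynomial σ R →ₐ[R] A)
    (h : ∀ i, κ (D (MvPolynomial.X i)) = E (κ (MvPolynomial.X i))) (x : MvPolynomial σ R) :
    κ (D x) = E (κ x) := by
  induction x using MvPolynomial.induction_on with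
  | C a => simp [← MvPolynomial.algebraMap_eq]
  | add p q hp hq => simp only [map_add, hp, hq]
  | mul_X p i hp => simp only [Derivation.leibniz, map_add, map_mul, smul_eq_mul, hp, h]

/-- The derivation of `H` that maps every tree `t` to the constant `α t`, i.e. the vector field with
constant coefficients `α` on the space of characters. -/
def treeDerivation (α : RTree → ℝ) : Derivation ℝ H H :=
  MvPolynomial.mkDerivation ℝ fun t => MvPolynomial.C (α t)

@[simp] theorem treeDerivation_tree (α : RTree → ℝ) (t : RTree) :
    treeDerivation α (tree t) = MvPolynomial.C (α t) :=
  MvPolynomial.mkDerivation_X _ _ _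

theorem treeDerivation_forest [DecidableEq RTree] (α : RTree → ℝ) (s : Multiset RTree) :
    treeDerivation α (forest s) = (s.map fun t => α t • forest (s.erase t)).sum := by
  rw [forest, derivation_multiset_prod]
  simp only [treeDerivation_tree, ← MvPolynomial.smul_eq_C_mul]
  rfl

/-- The coefficient of the tree `t` in the Taylor expansion of the elementary differential of
`u` along the B-series of `φ`, see `elementaryDifferential_expansion`. -/
def taylorCoeff (φ : Character) (u t : RTree) : ℝ :=
  u.symmetryFactor * MvPolynomial.coeff (Finsupp.single u 1) (trunk φ t)

theorem pderiv_trunk (φ : Character) (u t : RTree) :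
    MvPolynomial.pderiv u (trunk φ t) =
      MvPolynomial.C (MvPolynomial.coeff (Finsupp.single u 1) (trunk φ t)) := by
  classical
  have h : ∀ r, MvPolynomial.pderiv u (tree r) =
      MvPolynomial.C (MvPolynomial.coeff (Finsupp.single u 1) (tree r)) := fun r => by
    rcases eq_or_ne r u with rfl | h
    · simp [tree]
    · simp [tree, MvPolynomial.pderiv_X_of_ne h, MvPolynomial.coeff_X, Finsupp.single_left_inj, h]
  unfold trunk
  induction t.admCuts using Multiset.induction_on with
  | empty => simp
  | cons c s ih =>
    rw [Multiset.map_cons, Multiset.sum_cons, map_add, ih, Derivation.map_smul, h,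
      MvPolynomial.coeff_add, MvPolynomial.coeff_smul, smul_eq_mul, map_add, map_mul,
      MvPolynomial.smul_eq_C_mul]

/-- `σ(u) ∂/∂u`, the derivation of `H` whose value on forests pairs with the tree `u`. -/
def dualDerivation (u : RTree) : Derivation ℝ H H := (u.symmetryFactor : ℝ) • MvPolynomial.pderiv u

theorem translate_treeDerivation (φ : Character) (u : RTree) (x : H) :
    translate φ (treeDerivation (taylorCoeff φ u) x) = dualDerivation u (translate φ x) :=
  algHom_derivation_comm _ (fun t => by
    change translate φ (treeDerivation _ (tree t)) =
      (u.symmetryFactor : ℝ) • MvPolynomial.pderiv u (translate φ (tree t))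
    rw [treeDerivation_tree, translate_tree, map_add, pderiv_trunk, algHom_C, taylorCoeff,
      MvPolynomial.pderiv_C, zero_add, MvPolynomial.algebraMap_eq, MvPolynomial.smul_eq_C_mul,
      MvPolynomial.C_mul]) x

theorem counit_prod_dualDerivation [DecidableEq RTree] (us : List RTree) (x : H) :
    counit ((us.map fun u => (dualDerivation u).toLinearMap).prod x) =
      (RTree.node us).symmetryFactor *
        MvPolynomial.coeff (Multiset.toFinsupp (us : Multiset RTree)) x := by
  induction us using List.reverseRecOn generalizing x with
  | nil =>
    simp [counit, MvPolynomial.constantCoeff_eq, MvPolynomial.aeval_eq_constantCoeff_of_vars]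
  | append_singleton us u ih =>
    have hcons : ((us ++ [u] : List RTree) : Multiset RTree) = u ::ₘ us := by simp
    have hcoeff := MvPolynomial.coeff_pderiv (i := u) x (Multiset.toFinsupp (us : Multiset RTree))
    rw [List.map_append, List.prod_append, Module.End.mul_apply, ih, hcons, symmetryFactor_cons,
      ← Multiset.singleton_add, map_add, Multiset.toFinsupp_singleton,
      add_comm (Finsupp.single u 1)]
    simp only [List.map_singleton, List.prod_singleton,
      Derivation.coeFn_coe, dualDerivation, Derivation.smul_apply, MvPolynomial.coeff_smul, hcoeff,
      Multiset.toFinsupp_apply, smul_eq_mul]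
    push_cast
    ring

theorem coeff_single_graft [DecidableEq RTree] (s : Multiset RTree) (x : H) :
    MvPolynomial.coeff (Finsupp.single (RTree.node s) 1) (graft x) =
      MvPolynomial.coeff (Multiset.toFinsupp s) x :=
  LinearMap.congr_fun
    (f := MvPolynomial.lcoeff ℝ (Finsupp.single (RTree.node s) 1) ∘ₗ graft)
    (g := MvPolynomial.lcoeff ℝ (Multiset.toFinsupp s))
    (linearMap_ext_forest fun r => by
      rw [LinearMap.comp_apply, graft_forest, forest_eq_monomial]
      simp [tree, MvPolynomial.coeff_X, MvPolynomial.coeff_monomial, Finsupp.single_left_inj,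
        RTree.node_injective.eq_iff]) x

theorem apply_prod_treeDerivation (φ : Character) (us : List RTree) (s : Multiset RTree) :
    φ ((us.map fun u => (treeDerivation (taylorCoeff φ u)).toLinearMap).prod (forest s)) =
      taylorCoeff φ (RTree.node us) (RTree.node s) := by
  classical
  have hcomm : ∀ (us : List RTree) (x : H), translate φ
      ((us.map fun u => (treeDerivation (taylorCoeff φ u)).toLinearMap).prod x) =
      (us.map fun u => (dualDerivation u).toLinearMap).prod (translate φ x) := fun us => by
    induction us with
    | nil => simp
    | cons u us ih =>
      intro x
      simp only [List.map_cons, List.prod_cons, Module.End.mul_apply, ← ih]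
      exact translate_treeDerivation φ u _
  have hφ : ∀ x, φ x = counit (translate φ x) := fun x =>
    DFunLike.congr_fun ((mul_one φ).symm.trans (conv_eq_comp_translate φ counit)) x
  rw [hφ, hcomm, counit_prod_dualDerivation, taylorCoeff, trunk_node, coeff_single_graft]

/-! ### Truncated exponential series over forests -/

/-- The finite set of the trees with at most `K` nodes. -/
def treesLE (K : ℕ) : Finset RTree := (RTree.finite_order_le K).toFinset

@[simp] theorem mem_treesLE {K : ℕ} {t : RTree} : t ∈ treesLE K ↔ t.order ≤ K := by
  simp [treesLE]

/-- The finite set of the forests with at most `K` nodes. -/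
def forestsLE (K : ℕ) : Finset (Multiset RTree) :=
  ((RTree.finite_order_le (1 + K)).preimage RTree.node_injective.injOn).toFinset

@[simp] theorem mem_forestsLE {K : ℕ} {s : Multiset RTree} :
    s ∈ forestsLE K ↔ (s.map RTree.order).sum ≤ K := by
  simp [forestsLE, RTree.order_node]

theorem card_le_sum_order (s : Multiset RTree) : s.card ≤ (s.map RTree.order).sum := by
  simpa using Multiset.card_nsmul_le_sum (s := s.map RTree.order) (a := 1) (by
    simpa [Nat.one_le_iff_ne_zero] using fun t _ => (RTree.order_pos t).ne')

theorem counit_treeDerivation_pow (α : RTree → ℝ) (n : ℕ) (s : Multiset RTree) :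
    counit (((treeDerivation α).toLinearMap ^ n) (forest s)) =
      if s.card = n then n.factorial * (s.map α).prod else 0 := by
  classical
  induction n generalizing s with
  | zero =>
    rcases s.empty_or_exists_mem with rfl | ⟨t, ht⟩
    · simp
    · obtain ⟨s, rfl⟩ := Multiset.exists_cons_of_mem ht
      simp [counit, tree]
  | succ n ih =>
    have hterm : ∀ t ∈ s, α t * counit (((treeDerivation α).toLinearMap ^ n) (forest (s.erase t))) =
        if s.card = n + 1 then n.factorial * (s.map α).prod else 0 := fun t ht => by
      have hcard := Multiset.card_erase_add_one ht
      rw [ih, mul_ite, mul_zero, ← hcard, ← Multiset.prod_map_erase ht]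
      simp only [add_left_inj]
      split_ifs <;> ring
    rw [pow_succ, Module.End.mul_apply, Derivation.coeFn_coe,
      treeDerivation_forest, map_multiset_sum, map_multiset_sum, Multiset.map_map, Multiset.map_map,
      Multiset.map_congr rfl fun t ht => (by simpa using hterm t ht), Multiset.map_const',
      Multiset.sum_replicate, smul_ite, smul_zero, Nat.factorial_succ]
    split_ifs with h
    · rw [h]; push_cast; ring
    · rfl

section ForestSum

variable {𝒞 : Type*} [CommRing 𝒞] [Algebra ℝ 𝒞] (x : RTree → 𝒞) (K : ℕ)

/-- The truncated sum `∑ α(t) / σ(t) x(t)` over trees. -/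
def treeSum (α : RTree → ℝ) : 𝒞 := ∑ t ∈ treesLE K, (α t / t.symmetryFactor) • x t

/-- The truncated sum `∑ ℓ(t₁ ⋯ tₘ) / σ([t₁, …, tₘ]) x(t₁) ⋯ x(tₘ)` over forests. -/
def forestSum (ℓ : H →ₗ[ℝ] ℝ) : 𝒞 :=
  ∑ s ∈ forestsLE K, (ℓ (forest s) / (RTree.node s).symmetryFactor) • (s.map x).prod

theorem forestSum_counit : forestSum x K counit.toLinearMap = 1 := by
  rw [forestSum, Finset.sum_eq_single_of_mem 0 (by simp)]
  · simp
  · intro s _ hs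
    obtain ⟨t, ht⟩ := Multiset.exists_mem_of_ne_zero hs
    obtain ⟨s, rfl⟩ := Multiset.exists_cons_of_mem ht
    simp [counit, tree]

variable {x K} (hx : ∀ s : Multiset RTree, K < (s.map RTree.order).sum → (s.map x).prod = 0)
include hx

theorem smul_mul_forestSum [DecidableEq RTree] (t : RTree) (a : ℝ) (ℓ : H →ₗ[ℝ] ℝ) :
    (a / t.symmetryFactor) • x t * forestSum x K ℓ =
      ∑ r ∈ forestsLE K, (r.count t * (a * ℓ (forest (r.erase t))) /
        (RTree.node r).symmetryFactor) • (r.map x).prod := by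
  have hcons : ∀ s : Multiset RTree, (a / t.symmetryFactor) • x t *
      ((ℓ (forest s) / (RTree.node s).symmetryFactor) • (s.map x).prod) =
        ((t ::ₘ s).count t * (a * ℓ (forest ((t ::ₘ s).erase t))) /
          (RTree.node (t ::ₘ s)).symmetryFactor) • ((t ::ₘ s).map x).prod := fun s => by
    have hcount : ((s.count t : ℝ) + 1) ≠ 0 := Nat.cast_add_one_ne_zero _
    have ht := symmetryFactor_ne_zero t
    have hs := symmetryFactor_ne_zero (RTree.node s)
    rw [smul_mul_smul_comm, ← Multiset.prod_cons, ← Multiset.map_cons, symmetryFactor_cons,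
      Multiset.count_cons_self, Multiset.erase_cons_head]
    congr 1
    push_cast
    field_simp
  rw [forestSum, Finset.mul_sum, Finset.sum_congr rfl fun s _ => hcons s]
  refine Finset.sum_bij_ne_zero (fun s _ _ => t ::ₘ s)
    (fun s _ h => mem_forestsLE.2 (not_lt.1 fun hlt => h (by rw [hx _ hlt, smul_zero])))
    (fun _ _ _ _ _ _ h => (Multiset.cons_inj_right t).1 h) (fun r hr h => ?_) fun _ _ _ => rfl
  have ht : t ∈ r := by
    by_contra ht
    simp [Multiset.count_eq_zero_of_notMem ht] at h
  obtain ⟨s, rfl⟩ := Multiset.exists_cons_of_mem ht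
  refine ⟨s, mem_forestsLE.2 (le_trans ?_ (mem_forestsLE.1 hr)), h, rfl⟩
  simp

theorem treeSum_mul_forestSum (α : RTree → ℝ) (ℓ : H →ₗ[ℝ] ℝ) :
    treeSum x K α * forestSum x K ℓ = forestSum x K (ℓ ∘ₗ (treeDerivation α).toLinearMap) := by
  classical
  rw [treeSum, Finset.sum_mul, Finset.sum_congr rfl fun t _ => smul_mul_forestSum hx t (α t) ℓ,
    Finset.sum_comm, forestSum]
  refine Finset.sum_congr rfl fun r hr => ?_
  have hsub : r.toFinset ⊆ treesLE K := fun t ht => mem_treesLE.2 <|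
    (Multiset.single_le_sum (fun _ _ => Nat.zero_le _) _
      (Multiset.mem_map_of_mem _ (Multiset.mem_toFinset.1 ht))).trans (mem_forestsLE.1 hr)
  rw [← Finset.sum_smul, ← Finset.sum_div, LinearMap.comp_apply, Derivation.coeFn_coe,
    treeDerivation_forest, map_multiset_sum, Multiset.map_map, Finset.sum_multiset_map_count,
    Finset.sum_subset hsub fun t _ ht => by
      simp [Multiset.count_eq_zero_of_notMem (mt Multiset.mem_toFinset.2 ht)]]
  simp

theorem prod_treeSum_mul_forestSum {ι : Type*} (α : ι → RTree → ℝ) (l : List ι)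
    (ℓ : H →ₗ[ℝ] ℝ) :
    (l.map fun i => treeSum x K (α i)).prod * forestSum x K ℓ =
      forestSum x K (ℓ ∘ₗ (l.map fun i => (treeDerivation (α i)).toLinearMap).prod) := by
  induction l generalizing ℓ with
  | nil => simp; rfl
  | cons i l ih =>
    rw [List.map_cons, List.prod_cons, mul_comm (treeSum x K _), mul_assoc,
      treeSum_mul_forestSum hx, ih, List.map_cons, List.prod_cons]
    rfl

theorem treeSum_pow (α : RTree → ℝ) (n : ℕ) :
    treeSum x K α ^ n =
      forestSum x K (counit.toLinearMap ∘ₗ (treeDerivation α).toLinearMap ^ n) := by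
  simpa [forestSum_counit] using
    prod_treeSum_mul_forestSum hx (fun _ : Unit => α) (List.replicate n ()) counit.toLinearMap

theorem treeSum_pow_succ_eq_zero (α : RTree → ℝ) : treeSum x K α ^ (K + 1) = 0 := by
  rw [treeSum_pow hx, forestSum]
  refine Finset.sum_eq_zero fun s hs => ?_
  have hcard : s.card ≠ K + 1 := by
    have := card_le_sum_order s
    have := mem_forestsLE.1 hs
    lia
  simp [counit_treeDerivation_pow, hcard]

theorem exp_treeSum [Module ℚ 𝒞] (φ : Character) :
    IsNilpotent.exp (treeSum x K fun t => φ (tree t)) = forestSum x K φ.toLinearMap := by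
  rw [IsNilpotent.exp_eq_sum (treeSum_pow_succ_eq_zero hx _)]
  simp only [treeSum_pow hx, forestSum, Finset.smul_sum]
  rw [Finset.sum_comm]
  refine Finset.sum_congr rfl fun s hs => ?_
  have hcard : s.card ∈ Finset.range (K + 1) :=
    Finset.mem_range_succ_iff.2 ((card_le_sum_order s).trans (mem_forestsLE.1 hs))
  rw [Finset.sum_eq_single_of_mem _ hcard]
  · rw [← Rat.cast_smul_eq_qsmul ℝ, smul_smul, LinearMap.comp_apply, AlgHom.toLinearMap_apply,
      counit_treeDerivation_pow, if_pos rfl, ← algHom_forest]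
    push_cast
    rw [← mul_div_assoc, inv_mul_cancel_left₀ (by positivity)]
    rfl
  · intro n _ hn
    simp [counit_treeDerivation_pow, hn.symm]

theorem prod_treeSum_taylorCoeff_mul_exp [Module ℚ 𝒞] (φ : Character) (us : List RTree) :
    (us.map fun u => treeSum x K (taylorCoeff φ u)).prod *
        IsNilpotent.exp (treeSum x K fun t => φ (tree t)) =
      ∑ s ∈ forestsLE K, (taylorCoeff φ (RTree.node us) (RTree.node s) /
        (RTree.node s).symmetryFactor) • (s.map x).prod := by
  rw [exp_treeSum hx, prod_treeSum_mul_forestSum hx]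
  refine Finset.sum_congr rfl fun s _ => ?_
  rw [← apply_prod_treeDerivation]
  rfl

end ForestSum

/-! ### Lie series -/

open scoped IsMulCommutative in
theorem exists_mvPolynomial_aeval {ι R S : Type*} [CommRing R] [Ring S] [Algebra R S] (f : ι → S)
    (hf : ∀ i j, Commute (f i) (f j)) :
    ∃ ρ : MvPolynomial ι R →ₐ[R] S, ∀ i, ρ (MvPolynomial.X i) = f i := by
  have : IsMulCommutative (Algebra.adjoin R (Set.range f)) := Algebra.isMulCommutative_adjoin R (by
    rintro _ ⟨i, rfl⟩ _ ⟨j, rfl⟩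
    exact hf i j)
  let g : ι → Algebra.adjoin R (Set.range f) := fun i => ⟨f i, Algebra.subset_adjoin ⟨i, rfl⟩⟩
  exact ⟨(Algebra.adjoin R (Set.range f)).val.comp (MvPolynomial.aeval g), fun i => by simp [g]⟩

section LieSeries

variable {ι B A : Type*} [Fintype ι] [CommRing B] [CommRing A] [Algebra B A]

/-- The vector `b` as the symbol of a differential operator with constant coefficients. -/
def linearSymbol (b : ι → B) : MvPolynomial ι B := ∑ i, b i • MvPolynomial.X i

theorem linearSymbol_mul (c : B) (b : ι → B) :
    linearSymbol (fun i => c * b i) = c • linearSymbol b := by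
  simp only [linearSymbol, mul_smul, Finset.smul_sum]

theorem list_prod_linearSymbol {κ : Type*} (ε : B) (d : κ → ℕ) (b : κ → ι → B) (l : List κ) :
    (l.map fun k => linearSymbol fun i => ε ^ d k * b k i).prod =
      ε ^ (l.map d).sum • (l.map fun k => linearSymbol (b k)).prod := by
  induction l with
  | nil => simp
  | cons k l ih =>
    rw [List.map_cons, List.map_cons, List.map_cons, List.prod_cons, List.prod_cons, List.sum_cons,
      ih, linearSymbol_mul, smul_mul_smul_comm, pow_add]

/-- The `m`-th derivative of `g` in the directions of the vector fields `w₁, …, wₘ`, where the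
derivations `D i` play the role of the partial derivatives. The vector fields are not
differentiated. -/
def multiDeriv (D : ι → Derivation B A A) : List (ι → A) → A → A
  | [], g => g
  | w :: ws, g => ∑ i, w i * multiDeriv D ws (D i g)

theorem multiDeriv_perm {D : ι → Derivation B A A} (hD : ∀ i j g, D i (D j g) = D j (D i g))
    {ws ws' : List (ι → A)} (h : ws.Perm ws') (g : A) : multiDeriv D ws g = multiDeriv D ws' g := by
  induction h generalizing g with
  | nil => rfl
  | cons w _ ih => simp only [multiDeriv, ih]
  | swap w w' ws =>
    simp only [multiDeriv, Finset.mul_sum]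
    rw [Finset.sum_comm]
    simp only [hD, mul_left_comm]
  | trans _ _ ih ih' => rw [ih, ih']

theorem map_multiDeriv {B' A' : Type*} [CommRing B'] [CommRing A'] [Algebra B' A'] (κ : A →+* A')
    {D : ι → Derivation B A A} {D' : ι → Derivation B' A' A'}
    (hκ : ∀ i g, κ (D i g) = D' i (κ g)) (ws : List (ι → A)) (g : A) :
    κ (multiDeriv D ws g) = multiDeriv D' (ws.map fun w i => κ (w i)) (κ g) := by
  induction ws generalizing g with
  | nil => rfl
  | cons w ws ih => simp only [multiDeriv, List.map_cons, map_sum, map_mul, ih, hκ]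

variable {D : ι → Derivation B A A} {ρ : MvPolynomial ι B →ₐ[B] Module.End B A}
  (hρ : ∀ i, ρ (MvPolynomial.X i) = (D i).toLinearMap)
include hρ

theorem apply_multiDeriv {P : A →ₗ[B] B} {T : A →ₐ[B] B} {e : MvPolynomial ι B}
    (hT : ∀ g, T g = P (ρ e g)) (ws : List (ι → A)) (g : A) :
    T (multiDeriv D ws g) = P (ρ ((ws.map fun w => linearSymbol fun i => T (w i)).prod * e) g) := by
  induction ws generalizing g with
  | nil => simp [multiDeriv, hT]
  | cons w ws ih =>
    rw [multiDeriv, List.map_cons, List.prod_cons, linearSymbol, mul_assoc, mul_comm]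
    simp only [map_sum, map_mul, map_smul, ih, Finset.mul_sum, LinearMap.sum_apply, mul_smul_comm,
      Module.End.mul_apply, LinearMap.smul_apply, hρ, smul_eq_mul, Derivation.coeFn_coe]

theorem exists_algHom_exp [Module ℚ A] [Module ℚ B] (P : A →ₐ[B] B) {b : ι → B}
    (hb : IsNilpotent (linearSymbol b)) :
    ∃ T : A →ₐ[B] B, ∀ g, T g = P (ρ (IsNilpotent.exp (linearSymbol b)) g) := by
  have hlin : ∀ g, ρ (linearSymbol b) g = ∑ i, b i • D i g := fun g => by
    simp [linearSymbol, hρ]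
  have hleibniz : ∀ x y, ρ (linearSymbol b) (x * y) =
      x * ρ (linearSymbol b) y + ρ (linearSymbol b) x * y := fun x y => by
    simp only [hlin, Derivation.leibniz, smul_eq_mul, smul_add, Finset.sum_add_distrib,
      Finset.mul_sum, Finset.sum_mul, mul_smul_comm, smul_mul_assoc, mul_comm y]
  have hexp := IsNilpotent.map_exp hb ρ
  have hone : ρ (IsNilpotent.exp (linearSymbol b)) 1 = 1 := by
    obtain ⟨n, hn⟩ := hb.map ρ
    rw [hexp, IsNilpotent.exp_eq_sum (k := n + 1) (by rw [pow_succ, hn, zero_mul]),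
      LinearMap.sum_apply, Finset.sum_range_succ']
    simp [pow_succ, hlin]
  exact ⟨P.comp (AlgHom.ofLinearMap _ hone fun x y => by
    rw [hexp]
    exact Module.End.exp_mul_of_derivation B A _ hleibniz (hb.map ρ) x y), fun g => rfl⟩

end LieSeries

theorem sum_forestsLE_node {M : Type*} [AddCommMonoid M] {K : ℕ} {g : RTree → M}
    (hg : ∀ t, K < t.order → g t = 0) :
    ∑ s ∈ forestsLE K, g (.node s) = ∑ t ∈ treesLE K, g t := by
  refine Finset.sum_bij_ne_zero (fun s _ _ => .node s) (fun s _ hs => ?_)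
    (fun s _ _ s' _ _ h => RTree.node_injective h)
    (fun t ht h => ⟨t.children, ?_, ?_, t.node_children⟩) fun _ _ _ => rfl
  · exact mem_treesLE.2 (not_lt.1 (mt (hg _) hs))
  · rw [mem_treesLE, ← t.node_children, RTree.order_node] at ht
    exact mem_forestsLE.2 (by omega)
  · rwa [t.node_children]

section Expansion

variable {ι B A : Type*} [Fintype ι] [CommRing B] [CommRing A] [Algebra B A]
  {D : ι → Derivation B A A} {ρ : MvPolynomial ι B →ₐ[B] Module.End B A}
  (hρ : ∀ i, ρ (MvPolynomial.X i) = (D i).toLinearMap)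
  {f : ι → A} {F : RTree → ι → A}
  (hF : ∀ (us : List RTree) j, F (.node us) j = multiDeriv D (us.map F) (f j))
  (P : A →ₐ[B] B) {ε : B} {K : ℕ} (hε : ε ^ (K + 1) = 0)

/-- The symbol of the operator `∑ i, ε ^ |t| P(Fᵢ(t)) Dᵢ`. -/
def treeSymbol (F : RTree → ι → A) (P : A →ₐ[B] B) (ε : B) :
    RTree → MvPolynomial ι B :=
  fun t => linearSymbol fun i => ε ^ t.order * P (F t i)

theorem list_prod_treeSymbol (us : List RTree) :
    (us.map (treeSymbol F P ε)).prod =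
      ε ^ (us.map RTree.order).sum • (us.map fun u => linearSymbol fun i => P (F u i)).prod :=
  list_prod_linearSymbol ε RTree.order (fun u i => P (F u i)) us

include hε in
theorem prod_treeSymbol_eq_zero (s : Multiset RTree) (hs : K < (s.map RTree.order).sum) :
    (s.map (treeSymbol F P ε)).prod = 0 := by
  induction s using Quotient.inductionOn with
  | h us =>
    simp only [Multiset.quot_mk_to_coe, Multiset.map_coe, Multiset.prod_coe,
      Multiset.sum_coe] at hs ⊢
    rw [list_prod_treeSymbol, pow_eq_zero_of_le hs hε, zero_smul]

include hρ hF in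
theorem pow_mul_apply_forest (s : Multiset RTree) (j : ι) :
    ε * P (ρ (s.map (treeSymbol F P ε)).prod (f j)) =
      ε ^ (RTree.node s).order * P (F (.node s) j) := by
  induction s using Quotient.inductionOn with
  | h us =>
    simp only [Multiset.quot_mk_to_coe, Multiset.map_coe, Multiset.prod_coe]
    rw [list_prod_treeSymbol, hF, apply_multiDeriv hρ (P := P.toLinearMap) (e := 1) (by simp),
      RTree.order_node]
    simp [pow_add, mul_assoc, Function.comp_def]

variable [Algebra ℝ B]

theorem treeSum_treeSymbol (α : RTree → ℝ) :
    treeSum (treeSymbol F P ε) K α = linearSymbol fun i =>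
      ∑ t ∈ treesLE K, (α t / t.symmetryFactor) • (ε ^ t.order * P (F t i)) := by
  simp only [treeSum, treeSymbol, linearSymbol, Finset.smul_sum, Finset.sum_smul, smul_assoc]
  exact Finset.sum_comm

include hρ hF hε in
theorem elementaryDifferential_expansion [Module ℚ B] (φ : Character) {T : A →ₐ[B] B}
    (hT : ∀ g, T g = P (ρ (IsNilpotent.exp
      (treeSum (treeSymbol F P ε) K fun t => φ (tree t))) g)) (u : RTree) (j : ι) :
    ε ^ u.order * T (F u j) =
      ∑ t ∈ treesLE K, (taylorCoeff φ u t / t.symmetryFactor) • (ε ^ t.order * P (F t j)) := by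
  induction u using RTree.ind generalizing j with
  | h us ih =>
    induction us using Quotient.inductionOn with
    | h us =>
      have hsymbol : ∀ u ∈ us, (linearSymbol fun i => ε ^ u.order * T (F u i)) =
          treeSum (treeSymbol F P ε) K (taylorCoeff φ u) := fun u hu => by
        rw [treeSum_treeSymbol]
        exact congrArg _ (funext (ih u hu))
      have hsmul (c : ℝ) (q : MvPolynomial ι B) : P (ρ (c • q) (f j)) = c • P (ρ q (f j)) := by
        rw [← algebraMap_smul B c q, map_smul, LinearMap.smul_apply, map_smul, algebraMap_smul]
      have hprod := prod_treeSum_taylorCoeff_mul_exp (prod_treeSymbol_eq_zero P hε (F := F)) φ us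
      rw [← List.map_congr_left hsymbol,
        list_prod_linearSymbol ε RTree.order fun u i => T (F u i)] at hprod
      rw [Multiset.quot_mk_to_coe, hF, apply_multiDeriv hρ (P := P.toLinearMap) hT,
        RTree.order_node, pow_add, pow_one, mul_assoc]
      calc _ = ε * P (ρ (ε ^ (us.map RTree.order).sum •
            (us.map fun u => linearSymbol fun i => T (F u i)).prod *
              IsNilpotent.exp (treeSum (treeSymbol F P ε) K fun t => φ (tree t))) (f j)) := by
            simp [Function.comp_def]
        _ = ∑ s ∈ forestsLE K, (taylorCoeff φ (.node us) (.node s) /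
              (RTree.node s).symmetryFactor) •
                (ε ^ (RTree.node s).order * P (F (.node s) j)) := by
            rw [hprod]
            simp only [← pow_mul_apply_forest hρ hF P, map_sum, LinearMap.sum_apply, Finset.mul_sum,
              hsmul, mul_smul_comm]
        _ = _ := sum_forestsLE_node (g := fun t => (taylorCoeff φ (.node us) t /
              t.symmetryFactor) • (ε ^ t.order * P (F t j))) fun t ht => by
            rw [pow_eq_zero_of_le ht hε, zero_mul, smul_zero]

end Expansion

/-! ### Smooth functions -/

/-- The algebra of the smooth functions on `ℝᴺ`. -/
def smoothAlgebra (N : ℕ) : Subalgebra ℝ ((Fin N → ℝ) → ℝ) where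
  carrier := {g | ContDiff ℝ ∞ g}
  mul_mem' hg hg' := Set.mem_ofPred.2 ((Set.mem_ofPred.1 hg).mul (Set.mem_ofPred.1 hg'))
  add_mem' hg hg' := Set.mem_ofPred.2 ((Set.mem_ofPred.1 hg).add (Set.mem_ofPred.1 hg'))
  algebraMap_mem' _ := Set.mem_ofPred.2 contDiff_const

section SmoothAlgebra

variable {N : ℕ}

theorem smoothAlgebra.contDiff (g : smoothAlgebra N) : ContDiff ℝ ∞ g.1 := g.2

theorem smoothAlgebra.differentiable (g : smoothAlgebra N) : Differentiable ℝ g.1 :=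
  (smoothAlgebra.contDiff g).differentiable (by simp)

/-- The `i`-th partial derivative, as a derivation of the algebra of smooth functions. -/
def partialDeriv (i : Fin N) : Derivation ℝ (smoothAlgebra N) (smoothAlgebra N) :=
  Derivation.mk'
    { toFun := fun g => ⟨fun y => fderiv ℝ g.1 y (Pi.single i 1),
        ((smoothAlgebra.contDiff g).fderiv_right (m := ∞) (by norm_cast)).clm_apply contDiff_const⟩
      map_add' := fun g g' => Subtype.ext <| funext fun y =>
        DFunLike.congr_fun (fderiv_add (smoothAlgebra.differentiable g y)
          (smoothAlgebra.differentiable g' y)) (Pi.single i 1)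
      map_smul' := fun c g => Subtype.ext <| funext fun y =>
        DFunLike.congr_fun (fderiv_const_smul (smoothAlgebra.differentiable g y) c)
          (Pi.single i 1) }
    fun g g' => Subtype.ext <| funext fun y =>
      DFunLike.congr_fun (fderiv_mul (smoothAlgebra.differentiable g y)
        (smoothAlgebra.differentiable g' y)) (Pi.single i 1)

theorem partialDeriv_apply (i : Fin N) (g : smoothAlgebra N) (y : Fin N → ℝ) :
    (partialDeriv i g).1 y = fderiv ℝ g.1 y (Pi.single i 1) := rfl

theorem partialDeriv_comm (i j : Fin N) (g : smoothAlgebra N) :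
    partialDeriv i (partialDeriv j g) = partialDeriv j (partialDeriv i g) := by
  ext y
  have hsnd : ∀ i j, (partialDeriv i (partialDeriv j g)).1 y =
      fderiv ℝ (fderiv ℝ g.1) y (Pi.single i 1) (Pi.single j 1) := fun i j => by
    have hd : DifferentiableAt ℝ (fderiv ℝ g.1) y :=
      ((smoothAlgebra.contDiff g).fderiv_right (m := 1) (by norm_cast)).differentiable (by simp) y
    rw [partialDeriv_apply, funext (partialDeriv_apply j g),
      fderiv_clm_apply hd (differentiableAt_const _)]
    simp
  rw [hsnd, hsnd]
  exact ((smoothAlgebra.contDiff g).contDiffAt.isSymmSndFDerivAt (by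
    simpa using (WithTop.coe_le_coe.2 (le_top : (2 : ℕ∞) ≤ ⊤)))).eq _ _

theorem sum_mul_partialDeriv (g : smoothAlgebra N) (y a : Fin N → ℝ) :
    ∑ i, a i * (partialDeriv i g).1 y = fderiv ℝ g.1 y a := by
  conv_rhs => rw [pi_eq_sum_univ' a, map_sum]
  simp only [partialDeriv_apply, map_smul, smul_eq_mul]

/-- Evaluation of smooth functions at a point. -/
def evalAt (y : Fin N → ℝ) : smoothAlgebra N →ₐ[ℝ] ℝ :=
  (Pi.evalAlgHom ℝ (fun _ : Fin N → ℝ => ℝ) y).comp (smoothAlgebra N).val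

@[simp] theorem evalAt_apply (y : Fin N → ℝ) (g : smoothAlgebra N) : evalAt y g = g.1 y := rfl

theorem iteratedFDeriv_eq_of_symbol
    {ρ : MvPolynomial (Fin N) ℝ →ₐ[ℝ] Module.End ℝ (smoothAlgebra N)}
    (hρ : ∀ i, ρ (MvPolynomial.X i) = (partialDeriv i).toLinearMap) (g : smoothAlgebra N) {n : ℕ}
    (v : Fin n → Fin N → ℝ) (y : Fin N → ℝ) :
    iteratedFDeriv ℝ n g.1 y v = (ρ (∏ k, linearSymbol (v k)) g).1 y := by
  induction n generalizing y with
  | zero => simp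
  | succ n ih =>
    have hd : DifferentiableAt ℝ (iteratedFDeriv ℝ n g.1) y :=
      (smoothAlgebra.contDiff g).differentiable_iteratedFDeriv
        (by exact_mod_cast WithTop.coe_lt_top _) y
    rw [iteratedFDeriv_succ_apply_left, ← fderiv_continuousMultilinear_apply_const_apply hd,
      funext (ih (Fin.tail v)), ← sum_mul_partialDeriv, Fin.prod_univ_succ, map_mul,
      Module.End.mul_apply]
    simp [linearSymbol, hρ, Fin.tail_def]

theorem evalAt_multiDeriv (g : smoothAlgebra N) {n : ℕ} (W : Fin n → Fin N → smoothAlgebra N)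
    (y : Fin N → ℝ) :
    evalAt y (multiDeriv partialDeriv (List.ofFn W) g) =
      iteratedFDeriv ℝ n g.1 y fun k i => (W k i).1 y := by
  obtain ⟨ρ, hρ⟩ := exists_mvPolynomial_aeval (R := ℝ)
    (fun i : Fin N => (partialDeriv i).toLinearMap) fun i j =>
      LinearMap.ext (partialDeriv_comm i j)
  rw [iteratedFDeriv_eq_of_symbol hρ, apply_multiDeriv hρ (P := (evalAt y).toLinearMap) (e := 1)
    (by simp), mul_one, List.map_ofFn, List.prod_ofFn]
  rfl

/-- The components of a smooth map. -/
def component (f : SmoothField N) (j : Fin N) : smoothAlgebra N :=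
  ⟨fun y => f.1 y j, contDiff_pi.1 f.2 j⟩

theorem iteratedFDeriv_component (f : SmoothField N) (j : Fin N) {n : ℕ} (v : Fin n → Fin N → ℝ)
    (y : Fin N → ℝ) :
    iteratedFDeriv ℝ n (component f j).1 y v = iteratedFDeriv ℝ n f.1 y v j :=
  DFunLike.congr_fun (ContinuousLinearMap.iteratedFDeriv_comp_left
    (ContinuousLinearMap.proj (R := ℝ) (φ := fun _ : Fin N => ℝ) j)
    (f.2.contDiffAt (x := y)) (by exact_mod_cast le_top)) v

/-- The components of the elementary differentials, as smooth functions. -/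
def smoothElementary (f : SmoothField N) : RTree → Fin N → smoothAlgebra N :=
  RTree.para fun s j => multiDeriv partialDeriv (s.map Prod.snd).toList (component f j)

theorem smoothElementary_node (f : SmoothField N) (us : List RTree) (j : Fin N) :
    smoothElementary f (.node us) j =
      multiDeriv partialDeriv (us.map (smoothElementary f)) (component f j) := by
  rw [smoothElementary, RTree.para_node, ← smoothElementary]
  refine multiDeriv_perm (D := partialDeriv (N := N)) partialDeriv_comm ?_ _
  rw [← Multiset.coe_eq_coe, Multiset.coe_toList, Multiset.map_map]
  rfl

theorem smoothElementary_apply (f : SmoothField N) (t : RTree) (j : Fin N) (y : Fin N → ℝ) :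
    (smoothElementary f t j).1 y = elementaryDifferential f.1 t y j := by
  induction t using RTree.ind generalizing j with
  | h us ih =>
    induction us using Quotient.inductionOn with
    | h us =>
      rw [Multiset.quot_mk_to_coe, smoothElementary_node, elementaryDifferential_node f.2,
        ← iteratedFDeriv_component, ← evalAt_apply]
      conv_lhs => rw [← List.ofFn_get us, List.map_ofFn, evalAt_multiDeriv]
      congr! 3 with k i
      exact ih _ (us.get_mem k) i

theorem contDiff_elementaryDifferential (f : SmoothField N) (t : RTree) :
    ContDiff ℝ ∞ (elementaryDifferential f.1 t) :=
  contDiff_pi.2 fun j =>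
    (funext (smoothElementary_apply f t j)) ▸ smoothAlgebra.contDiff (smoothElementary f t j)

end SmoothAlgebra

/-! ### Formal Taylor expansion -/

theorem sum_pow_eq_sum_piFinset {R : Type*} [CommSemiring R] (x : ℕ → R) (S : Finset ℕ) (n : ℕ) :
    (∑ m ∈ S, x m) ^ n =
      ∑ v ∈ Fintype.piFinset fun _ : Fin n => S, ((List.ofFn v).map x).prod := by
  simp only [List.map_ofFn, List.prod_ofFn, Function.comp_apply]
  rw [← Finset.prod_univ_sum]
  simp

section ExpCurve

variable {𝒞 : Type*} [CommRing 𝒞] {x : ℕ → 𝒞} {K : ℕ}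
  (hx : ∀ l : List ℕ, K < l.sum → (l.map x).prod = 0)
include hx

theorem sum_Ico_pow_succ_eq_zero : (∑ m ∈ Finset.Ico 1 (K + 1), x m) ^ (K + 1) = 0 := by
  rw [sum_pow_eq_sum_piFinset]
  refine Finset.sum_eq_zero fun v hv => hx _ ?_
  have hpos : ∀ k, 1 ≤ v k := fun k => (Finset.mem_Ico.1 (Fintype.mem_piFinset.1 hv k)).1
  rw [List.sum_ofFn]
  calc K < ∑ _ : Fin (K + 1), 1 := by simp
    _ ≤ ∑ k, v k := Finset.sum_le_sum fun k _ => hpos k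

theorem exp_sum_eq_sum_composition [Module ℚ 𝒞] :
    IsNilpotent.exp (∑ m ∈ Finset.Ico 1 (K + 1), x m) =
      ∑ n ∈ Finset.range (K + 1), ∑ c : Composition n,
        (c.length.factorial : ℚ)⁻¹ • (c.blocks.map x).prod := by
  let term : (Σ n, Composition n) → 𝒞 := fun c =>
    (c.2.length.factorial : ℚ)⁻¹ • (c.2.blocks.map x).prod
  rw [IsNilpotent.exp_eq_sum (sum_Ico_pow_succ_eq_zero hx)]
  simp only [sum_pow_eq_sum_piFinset, Finset.smul_sum, Finset.range_eq_Ico]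
  rw [Finset.sum_sigma', Finset.sum_sigma']
  refine (FormalMultilinearSeries.compChangeOfVariables_sum 0 (K + 1) (K + 1) _ term
    fun v hv => ?_).trans (Finset.sum_subset (fun c hc => ?_) fun c _ hc => ?_).symm
  · simp only [term, FormalMultilinearSeries.compChangeOfVariables_length]
    rfl
  · have hle : c.1 ≤ K := by simpa [Nat.lt_succ_iff] using hc
    have := c.2.length_le
    refine FormalMultilinearSeries.mem_compPartialSumTarget_iff.2
      ⟨Nat.zero_le _, by omega, fun k => ?_⟩
    have := c.2.blocksFun_le k
    omega
  · have hlt : K < c.2.blocks.sum := by simpa [c.2.blocks_sum, Nat.lt_succ_iff] using hc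
    simp only [term, hx _ hlt, smul_zero]

end ExpCurve

section BaseChange

variable (B : Type*) [CommRing B] [Algebra ℝ B] {N : ℕ}

/-- The partial derivatives of smooth functions with coefficients in `B`. -/
def baseChangeDeriv (i : Fin N) :
    Derivation B (B ⊗[ℝ] smoothAlgebra N) (B ⊗[ℝ] smoothAlgebra N) :=
  Derivation.mk' ((partialDeriv i).toLinearMap.baseChange B) fun a a' => by
    induction a using TensorProduct.induction_on with
    | zero => simp
    | add a₁ a₂ h₁ h₂ => simp only [add_mul, map_add, h₁, h₂, add_smul, smul_add]; abel
    | tmul c g =>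
      induction a' using TensorProduct.induction_on with
      | zero => simp
      | add a₁ a₂ h₁ h₂ => simp only [mul_add, map_add, h₁, h₂, add_smul, smul_add]; abel
      | tmul c' g' => simp [TensorProduct.tmul_add, mul_comm c]

@[simp] theorem baseChangeDeriv_tmul (i : Fin N) (c : B) (g : smoothAlgebra N) :
    baseChangeDeriv B i (c ⊗ₜ g) = c ⊗ₜ partialDeriv i g := rfl

theorem exists_diffOp : ∃ ρ : MvPolynomial (Fin N) B →ₐ[B] Module.End B (B ⊗[ℝ] smoothAlgebra N),
    ∀ i, ρ (MvPolynomial.X i) = (baseChangeDeriv B i).toLinearMap :=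
  exists_mvPolynomial_aeval (fun i => (baseChangeDeriv B i).toLinearMap) fun i j => by
    refine TensorProduct.AlgebraTensorModule.curry_injective ?_
    ext g
    simp [partialDeriv_comm i j g]

variable {B}

theorem one_tmul_multiDeriv (ws : List (Fin N → smoothAlgebra N)) (g : smoothAlgebra N) :
    (1 : B) ⊗ₜ[ℝ] multiDeriv partialDeriv ws g =
      multiDeriv (baseChangeDeriv B) (ws.map fun w i => 1 ⊗ₜ w i) (1 ⊗ₜ g) :=
  map_multiDeriv (D' := baseChangeDeriv B)
    (Algebra.TensorProduct.includeRight : smoothAlgebra N →ₐ[ℝ] B ⊗[ℝ] smoothAlgebra N).toRingHom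
    (fun _ _ => rfl) ws g

/-- Evaluation at a point of smooth functions with coefficients in `B`. -/
def formalEval (B : Type*) [CommRing B] [Algebra ℝ B] (y : Fin N → ℝ) :
    B ⊗[ℝ] smoothAlgebra N →ₐ[B] B :=
  Algebra.TensorProduct.lift (AlgHom.id B B) ((Algebra.ofId ℝ B).comp (evalAt y))
    fun _ _ => Commute.all _ _

@[simp] theorem formalEval_one_tmul (y : Fin N → ℝ) (g : smoothAlgebra N) :
    formalEval B y (1 ⊗ₜ g) = algebraMap ℝ B (g.1 y) := by
  simp [formalEval, Algebra.ofId_apply]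

variable {ρ : MvPolynomial (Fin N) B →ₐ[B] Module.End B (B ⊗[ℝ] smoothAlgebra N)}
  (hρ : ∀ i, ρ (MvPolynomial.X i) = (baseChangeDeriv B i).toLinearMap)
include hρ

theorem formalEval_prod_linearSymbol (y : Fin N → ℝ) (g : smoothAlgebra N) {n : ℕ}
    (v : Fin n → Fin N → ℝ) :
    formalEval B y (ρ (∏ k, linearSymbol fun i => algebraMap ℝ B (v k i)) (1 ⊗ₜ g)) =
      algebraMap ℝ B (iteratedFDeriv ℝ n g.1 y v) := by
  have h := apply_multiDeriv hρ (P := (formalEval B y).toLinearMap) (T := formalEval B y) (e := 1)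
    (by simp) ((List.ofFn fun k i => algebraMap ℝ (smoothAlgebra N) (v k i)).map
      fun w i => 1 ⊗ₜ w i) (1 ⊗ₜ g)
  rw [← one_tmul_multiDeriv, formalEval_one_tmul, ← evalAt_apply, evalAt_multiDeriv] at h
  simp only [mul_one, List.map_ofFn, List.prod_ofFn, Function.comp_apply,
    formalEval_one_tmul] at h
  exact h.symm

theorem formalEval_exp_component [Algebra ℚ B] {ε : B} {K : ℕ} (hε : ε ^ (K + 1) = 0)
    (g : SmoothField N) (Ψ : FormalMap N) {y : Fin N → ℝ} (hΨ : Ψ 0 y = y) (j : Fin N) :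
    formalEval B y (ρ (IsNilpotent.exp (linearSymbol fun i =>
      ∑ m ∈ Finset.Ico 1 (K + 1), ε ^ m * algebraMap ℝ B (Ψ m y i))) (1 ⊗ₜ component g j)) =
    ∑ n ∈ Finset.range (K + 1), ε ^ n * algebraMap ℝ B (FormalMap.substCoeff g.1 Ψ n y j) := by
  have hprod := fun l : List ℕ =>
    list_prod_linearSymbol ε id (fun m i => algebraMap ℝ B (Ψ m y i)) l
  simp only [id_eq, List.map_id] at hprod
  have hsum : (linearSymbol fun i => ∑ m ∈ Finset.Ico 1 (K + 1), ε ^ m * algebraMap ℝ B (Ψ m y i)) =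
      ∑ m ∈ Finset.Ico 1 (K + 1), linearSymbol fun i => ε ^ m * algebraMap ℝ B (Ψ m y i) := by
    simp only [linearSymbol, Finset.sum_smul]
    exact Finset.sum_comm
  rw [hsum, exp_sum_eq_sum_composition fun l hl => by
    rw [hprod, pow_eq_zero_of_le hl hε, zero_smul]]
  have hterm : ∀ n (c : Composition n), formalEval B y (ρ ((c.length.factorial : ℚ)⁻¹ •
      (c.blocks.map fun m => linearSymbol fun i => ε ^ m * algebraMap ℝ B (Ψ m y i)).prod)
        (1 ⊗ₜ component g j)) = ε ^ n * algebraMap ℝ B ((c.length.factorial : ℝ)⁻¹ *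
          iteratedFDeriv ℝ c.length g.1 y (fun k => Ψ (c.blocksFun k) y) j) := fun n c => by
    rw [map_rat_smul, LinearMap.smul_apply, map_rat_smul, hprod, c.blocks_sum, map_smul,
      LinearMap.smul_apply, map_smul, ← c.ofFn_blocksFun, List.map_ofFn, List.prod_ofFn]
    simp only [Function.comp_apply]
    rw [formalEval_prod_linearSymbol hρ y _ fun k => Ψ (c.blocksFun k) y,
      iteratedFDeriv_component, ← Rat.cast_smul_eq_qsmul ℝ, Algebra.smul_def,
      smul_eq_mul, map_mul, Rat.cast_inv, Rat.cast_natCast]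
    ring
  simp only [map_sum, LinearMap.sum_apply, hterm, ← Finset.mul_sum, FormalMap.substCoeff,
    Finset.sum_apply, Pi.smul_apply, smul_eq_mul, hΨ]

end BaseChange

/-- The algebra of the polynomials in one variable modulo degree `> K`. -/
abbrev TruncatedPolynomial (K : ℕ) : Type := AdjoinRoot (Polynomial.X ^ (K + 1) : Polynomial ℝ)

namespace TruncatedPolynomial

/-- The class of the variable. -/
def var (K : ℕ) : TruncatedPolynomial K := AdjoinRoot.root _

/-- The coefficient of the highest power of the variable. -/
def topCoeff (K : ℕ) : TruncatedPolynomial K →ₗ[ℝ] ℝ :=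
  Polynomial.lcoeff ℝ K ∘ₗ AdjoinRoot.modByMonicHom (Polynomial.monic_X_pow (K + 1))

theorem var_pow_succ (K : ℕ) : var K ^ (K + 1) = 0 := by
  simpa [var] using AdjoinRoot.eval₂_root (Polynomial.X ^ (K + 1) : Polynomial ℝ)

theorem topCoeff_var_pow_mul (K n : ℕ) (a : ℝ) :
    topCoeff K (var K ^ n * algebraMap ℝ _ a) = if n = K then a else 0 := by
  rcases Nat.lt_or_ge K n with hn | hn
  · simp [pow_eq_zero_of_le hn (var_pow_succ K), hn.ne']
  have hdeg : (Polynomial.X ^ n : Polynomial ℝ).degree <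
      (Polynomial.X ^ (K + 1) : Polynomial ℝ).degree := by
    rw [Polynomial.degree_X_pow, Polynomial.degree_X_pow]
    exact_mod_cast Nat.lt_succ_of_le hn
  rw [mul_comm, ← Algebra.smul_def, map_smul, topCoeff, LinearMap.comp_apply, var,
    ← AdjoinRoot.mk_X, ← map_pow, AdjoinRoot.modByMonicHom_mk,
    (Polynomial.modByMonic_eq_self_iff (Polynomial.monic_X_pow _)).2 hdeg, Polynomial.lcoeff_apply,
    Polynomial.coeff_X_pow]
  simp [eq_comm]

end TruncatedPolynomial

theorem sum_treesLE {M : Type*} [AddCommMonoid M] (K : ℕ) (G : RTree → M) :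
    ∑ t ∈ treesLE K, G t = ∑ m ∈ Finset.Ico 1 (K + 1), ∑ t ∈ RTree.ofOrder m, G t := by
  rw [← Finset.sum_fiberwise_of_maps_to (s := treesLE K) (t := Finset.Ico 1 (K + 1))
    (g := RTree.order) fun t ht => Finset.mem_Ico.2
      ⟨t.order_pos, Nat.lt_succ_iff.2 (mem_treesLE.1 ht)⟩]
  refine Finset.sum_congr rfl fun m hm => Finset.sum_congr ?_ fun _ _ => rfl
  ext t
  simp only [Finset.mem_filter, mem_treesLE, RTree.mem_ofOrder]
  have := (Finset.mem_Ico.1 hm).2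
  omega

theorem sum_treesLE_eq_sum_bSeries {B : Type*} [CommRing B] [Algebra ℝ B] (φ : Character) {N : ℕ}
    (f : SmoothField N) (ε : B) (K : ℕ) (y : Fin N → ℝ) (i : Fin N) :
    ∑ t ∈ treesLE K, (φ (tree t) / t.symmetryFactor) •
        (ε ^ t.order * algebraMap ℝ B (elementaryDifferential f.1 t y i)) =
      ∑ m ∈ Finset.Ico 1 (K + 1), ε ^ m * algebraMap ℝ B (bSeries φ N f m y i) := by
  rw [sum_treesLE]
  refine Finset.sum_congr rfl fun m hm => ?_
  have hm0 : m ≠ 0 := (Nat.one_le_iff_ne_zero).1 (Finset.mem_Ico.1 hm).1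
  simp only [bSeries, if_neg hm0, Finset.sum_apply, Pi.smul_apply, map_sum, Finset.mul_sum]
  refine Finset.sum_congr rfl fun t ht => ?_
  rw [RTree.mem_ofOrder.1 ht, smul_eq_mul, map_mul, Algebra.smul_def, mul_left_comm]

theorem pow_mul_sum_substCoeff {B : Type*} [CommRing B] [Algebra ℝ B] [Algebra ℚ B] {ε : B} {K : ℕ}
    (hε : ε ^ (K + 1) = 0) (φ : Character) {N : ℕ} (f : SmoothField N) (u : RTree)
    (y : Fin N → ℝ) (j : Fin N) :
    ε ^ u.order * ∑ n ∈ Finset.range (K + 1), ε ^ n * algebraMap ℝ B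
        (FormalMap.substCoeff (elementaryDifferential f.1 u) (bSeries φ N f) n y j) =
      ∑ t ∈ treesLE K, (taylorCoeff φ u t / t.symmetryFactor) •
        (ε ^ t.order * algebraMap ℝ B (elementaryDifferential f.1 t y j)) := by
  obtain ⟨ρ, hρ⟩ := exists_diffOp B (N := N)
  let F : RTree → Fin N → B ⊗[ℝ] smoothAlgebra N := fun t i => 1 ⊗ₜ smoothElementary f t i
  have hF (us : List RTree) j : F (.node us) j =
      multiDeriv (baseChangeDeriv B) (us.map F) (1 ⊗ₜ component f j) := by
    simp only [F, smoothElementary_node, one_tmul_multiDeriv, List.map_map]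
    rfl
  have hPF t i : formalEval B y (F t i) = algebraMap ℝ B (elementaryDifferential f.1 t y i) := by
    simp only [F, formalEval_one_tmul, smoothElementary_apply]
  have hb := treeSum_treeSymbol (K := K) (F := F) (formalEval B y) (ε := ε) fun t => φ (tree t)
  simp only [hPF, sum_treesLE_eq_sum_bSeries] at hb
  have hnil := treeSum_pow_succ_eq_zero (prod_treeSymbol_eq_zero (F := F) (formalEval B y) hε)
    fun t => φ (tree t)
  rw [hb] at hnil
  obtain ⟨T, hT⟩ := exists_algHom_exp hρ (formalEval B y) ⟨K + 1, hnil⟩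
  have hcomp : smoothElementary f u j = component ⟨_, contDiff_elementaryDifferential f u⟩ j :=
    Subtype.ext (funext (smoothElementary_apply f u j))
  have hTF : T (F u j) = ∑ n ∈ Finset.range (K + 1), ε ^ n * algebraMap ℝ B
      (FormalMap.substCoeff (elementaryDifferential f.1 u) (bSeries φ N f) n y j) := by
    rw [hT]
    simp only [F, hcomp]
    exact formalEval_exp_component hρ hε _ (bSeries φ N f) rfl j
  rw [← hTF, elementaryDifferential_expansion hρ hF (formalEval B y) hε φ (by rwa [hb])]
  simp only [hPF]

open TruncatedPolynomial in
theorem substCoeff_elementaryDifferential (φ : Character) {N : ℕ} (f : SmoothField N) (u : RTree)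
    (n : ℕ) (y : Fin N → ℝ) :
    FormalMap.substCoeff (elementaryDifferential f.1 u) (bSeries φ N f) n y =
      ∑ t ∈ RTree.ofOrder (u.order + n),
        (taylorCoeff φ u t / t.symmetryFactor) • elementaryDifferential f.1 t y := by
  funext j
  let K := u.order + n
  have h := congrArg (topCoeff K) (pow_mul_sum_substCoeff (var_pow_succ K) φ f u y j)
  have hn : n ∈ Finset.range (K + 1) := by simp [K]
  have hfilter : (treesLE K).filter (fun t => t.order = K) = RTree.ofOrder K := by
    ext t
    simpa using le_of_eq
  simp only [Finset.mul_sum, ← mul_assoc, ← pow_add, map_sum, map_smul, topCoeff_var_pow_mul,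
    smul_ite, smul_zero, ← Finset.sum_filter, hfilter] at h
  simpa [Finset.filter_eq', hn, K] using h

/-! ### Composition of B-series -/

theorem order_le_of_mem_admCuts {t : RTree} {c : RTree × Multiset RTree} (hc : c ∈ t.admCuts) :
    c.1.order ≤ t.order := by
  induction t using RTree.ind generalizing c with
  | h s ih =>
    rw [RTree.admCuts_node] at hc
    obtain ⟨choice, hchoice, rfl⟩ := Multiset.mem_map.1 hc
    rw [RTree.order_node, RTree.order_node, Nat.add_le_add_iff_left]
    rw [Multiset.mem_sections, Multiset.rel_map_left] at hchoice
    clear hc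
    induction hchoice with
    | zero => simp
    | @cons t p s _ hp _ hle =>
      have hroot : (p.1.map RTree.order).sum ≤ t.order := by
        rcases Multiset.mem_add.1 hp with hp | hp
        · obtain ⟨c, hc, rfl⟩ := Multiset.mem_map.1 hp
          simpa using ih t (Multiset.mem_cons_self t s) hc
        · rw [Multiset.mem_singleton.1 hp]
          simp
      simp only [Multiset.map_cons, Multiset.sum_cons, Multiset.map_add, Multiset.sum_add]
      exact add_le_add hroot (hle fun u hu => ih u (Multiset.mem_cons_of_mem hu))

theorem sum_mul_coeff_trunk (φ₁ φ₂ : Character) (t : RTree) :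
    ∑ u ∈ treesLE t.order, φ₂ (tree u) * MvPolynomial.coeff (Finsupp.single u 1) (trunk φ₁ t) =
      φ₂ (trunk φ₁ t) := by
  classical
  have hcoeff : ∀ u, MvPolynomial.coeff (Finsupp.single u 1) (trunk φ₁ t) =
      (t.admCuts.map fun c => if c.1 = u then φ₁ (forest c.2) else 0).sum := fun u => by
    rw [trunk, ← MvPolynomial.lcoeff_apply, map_multiset_sum, Multiset.map_map]
    simp [tree, MvPolynomial.coeff_X, Finsupp.single_left_inj, Function.comp_def]
  simp only [hcoeff, ← Multiset.sum_map_mul_left, mul_ite, mul_zero]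
  rw [Finset.sum, Multiset.sum_map_sum_map, trunk, map_multiset_sum, Multiset.map_map]
  refine congrArg _ (Multiset.map_congr rfl fun c hc => ?_)
  refine (Finset.sum_ite_eq _ _ _).trans ?_
  rw [if_pos (mem_treesLE.2 (order_le_of_mem_admCuts hc))]
  simp [mul_comm]

theorem conv_tree (φ₁ φ₂ : Character) (t : RTree) :
    conv φ₁ φ₂ (tree t) = φ₁ (tree t) +
      ∑ u ∈ treesLE t.order, φ₂ (tree u) / u.symmetryFactor * taylorCoeff φ₁ u t := by
  have hterm : ∀ u, φ₂ (tree u) / u.symmetryFactor * taylorCoeff φ₁ u t =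
      φ₂ (tree u) * MvPolynomial.coeff (Finsupp.single u 1) (trunk φ₁ t) := fun u => by
    have := symmetryFactor_ne_zero u
    rw [taylorCoeff]
    field_simp
  simp only [hterm]
  rw [sum_mul_coeff_trunk, conv_apply, translate_tree, map_add, algHom_C]
  rfl

theorem iteratedFDeriv_id_of_two_le {E : Type*} [NormedAddCommGroup E] [NormedSpace ℝ E] {k : ℕ}
    (hk : 2 ≤ k) : iteratedFDeriv ℝ k (fun z : E => z) = 0 := by
  obtain ⟨k, rfl⟩ := Nat.exists_eq_add_of_le' hk
  funext z
  rw [iteratedFDeriv_succ_eq_comp_right]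
  simp [iteratedFDeriv_succ_const]

namespace FormalMap

variable {N : ℕ} (Ψ : FormalMap N) (n : ℕ) (y : Fin N → ℝ)

theorem substCoeff_sum {κ : Type*} (s : Finset κ) (c : κ → ℝ)
    {g : κ → (Fin N → ℝ) → (Fin N → ℝ)} (hg : ∀ k, ContDiff ℝ ∞ (g k)) :
    substCoeff (fun z => ∑ k ∈ s, c k • g k z) Ψ n y = ∑ k ∈ s, c k • substCoeff (g k) Ψ n y := by
  have hdiff : ∀ (m : ℕ) k, ContDiff ℝ m (g k) := fun m k => (hg k).of_le (by exact_mod_cast le_top)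
  have hterm : ∀ m z, iteratedFDeriv ℝ m (fun z => ∑ k ∈ s, c k • g k z) z =
      ∑ k ∈ s, c k • iteratedFDeriv ℝ m (g k) z := fun m z => by
    rw [iteratedFDeriv_sum fun k _ => (hdiff m k).const_smul (c k), Finset.sum_apply]
    exact Finset.sum_congr rfl fun k _ =>
      iteratedFDeriv_const_smul_apply' (hdiff m k).contDiffAt
  simp only [substCoeff, hterm, sum_apply, smul_apply, Finset.smul_sum]
  rw [Finset.sum_comm]
  simp only [smul_comm (c _)]

theorem substCoeff_zero (g : (Fin N → ℝ) → (Fin N → ℝ)) : substCoeff g Ψ 0 y = g (Ψ 0 y) := by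
  have hterm : ∀ (k : ℕ) (v : Fin k → (Fin N → ℝ)), k = 0 →
      ((k.factorial : ℝ)⁻¹) • iteratedFDeriv ℝ k g (Ψ 0 y) v = g (Ψ 0 y) := by
    rintro k v rfl
    simp
  rw [substCoeff, Finset.sum_congr rfl fun c _ => hterm _ _ (Nat.le_zero.1 c.length_le)]
  simp [composition_card]

theorem substCoeff_id : substCoeff (fun z => z) Ψ n y = Ψ n y := by
  rcases Nat.eq_zero_or_pos n with rfl | hn
  · exact substCoeff_zero Ψ y _
  have hterm : ∀ (k : ℕ) (v : Fin k → (Fin N → ℝ)), 2 ≤ k →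
      iteratedFDeriv ℝ k (fun z => z) (Ψ 0 y) v = 0 := fun k v hk => by
    rw [iteratedFDeriv_id_of_two_le hk]
    rfl
  have hlinear : ∀ (k : ℕ) (v : Fin k → (Fin N → ℝ)) (a : Fin N → ℝ), k = 1 → (∀ i, v i = a) →
      ((k.factorial : ℝ)⁻¹) • iteratedFDeriv ℝ k (fun z => z) (Ψ 0 y) v = a := by
    rintro k v a rfl hv
    simp [hv]
  rw [substCoeff, Finset.sum_eq_single (Composition.single n hn) (fun c _ hc => ?_) (by simp)]
  · exact hlinear _ _ _ (Composition.single_length hn) fun i => by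
      rw [Composition.single_blocksFun]
  · have hlength : c.length ≠ 1 := mt (Composition.eq_single_iff_length hn).2 hc
    have hpos : 0 < c.length := c.length_pos_of_pos hn
    rw [hterm _ _ (by lia), smul_zero]

end FormalMap

theorem bSeries_comp {N : ℕ} (φ₁ φ₂ : Character) (f : SmoothField N) :
    (bSeries φ₂ N f).comp (bSeries φ₁ N f) = bSeries (conv φ₁ φ₂) N f := by
  funext n y
  let F : RTree → Fin N → ℝ := fun t => elementaryDifferential f.1 t y
  have hterm : ∀ m ∈ Finset.Ico 1 (n + 1),
      FormalMap.substCoeff (bSeries φ₂ N f m) (bSeries φ₁ N f) (n - m) y =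
        ∑ u ∈ RTree.ofOrder m, (φ₂ (tree u) / u.symmetryFactor) •
          ∑ t ∈ RTree.ofOrder n, (taylorCoeff φ₁ u t / t.symmetryFactor) • F t := by
    intro m hm
    obtain ⟨hm1, hmn⟩ := Finset.mem_Ico.1 hm
    have hfun : bSeries φ₂ N f m = fun z => ∑ u ∈ RTree.ofOrder m,
        (φ₂ (tree u) / u.symmetryFactor) • elementaryDifferential f.1 u z := by
      funext z
      rw [bSeries, if_neg (by lia)]
    rw [hfun, FormalMap.substCoeff_sum _ _ _ _ _ fun u => contDiff_elementaryDifferential f u]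
    refine Finset.sum_congr rfl fun u hu => ?_
    rw [substCoeff_elementaryDifferential, RTree.mem_ofOrder.1 hu,
      Nat.add_sub_cancel' (Nat.lt_succ_iff.1 hmn)]
  have hid : bSeries φ₂ N f 0 = fun z => z := funext fun z => if_pos rfl
  rw [FormalMap.comp, Finset.Nat.sum_antidiagonal_eq_sum_range_succ_mk, Finset.range_eq_Ico,
    Finset.sum_eq_sum_Ico_succ_bot n.succ_pos, Finset.sum_congr rfl hterm, ← sum_treesLE, hid,
    FormalMap.substCoeff_id]
  rcases eq_or_ne n 0 with rfl | hn
  · simp [sum_treesLE, bSeries]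
  · simp only [bSeries, Nat.sub_zero, if_neg hn, Finset.smul_sum]
    rw [Finset.sum_comm, ← Finset.sum_add_distrib]
    refine Finset.sum_congr rfl fun t ht => ?_
    rw [conv_tree, RTree.mem_ofOrder.1 ht, add_div, add_smul, Finset.sum_div, Finset.sum_smul]
    simp only [smul_smul, mul_div_assoc, F]

/-! ### Independence of the elementary differentials -/

section Separation

variable {N : ℕ} (idx : Fin N → RTree)

/-- The `i`-th coordinate function on `ℝᴺ`. -/
def coordinate (i : Fin N) : smoothAlgebra N := component ⟨fun y => y, contDiff_id⟩ i

theorem partialDeriv_coordinate (i j : Fin N) :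
    partialDeriv i (coordinate j) = if i = j then 1 else 0 := by
  ext y
  have hfderiv : fderiv ℝ (fun z : Fin N → ℝ => z j) y = ContinuousLinearMap.proj j :=
    (ContinuousLinearMap.proj (R := ℝ) (φ := fun _ : Fin N => ℝ) j).fderiv
  rw [partialDeriv_apply, coordinate, component, hfderiv,
    ContinuousLinearMap.proj_apply, Pi.single_apply]
  simp only [eq_comm (a := j)]
  split_ifs <;> rfl

/-- The evaluation of the elements of `H` as polynomial functions on `ℝᴺ`, where the `i`-th
coordinate stands for the tree `idx i`; the trees that are not of this form are mapped to `0`. -/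
def treeCoordinates : H →ₐ[ℝ] smoothAlgebra N :=
  MvPolynomial.aeval (Function.extend idx coordinate 0)

/-- The vector field on `ℝᴺ` whose component in the direction of the tree `[τ₁, …, τₘ]` is the
product of the coordinates of `τ₁, …, τₘ`. It separates the elementary differentials. -/
def treeField : SmoothField N :=
  ⟨fun y j => (treeCoordinates idx (forest (idx j).children)).1 y,
    contDiff_pi.2 fun _ => smoothAlgebra.contDiff _⟩

theorem evalAt_zero_treeCoordinates (x : H) : evalAt 0 (treeCoordinates idx x) = counit x := by
  refine DFunLike.congr_fun (f := (evalAt 0).comp (treeCoordinates idx))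
    (algHom_ext_tree fun s => ?_) x
  simp only [AlgHom.comp_apply, treeCoordinates, tree, counit, MvPolynomial.aeval_X,
    Function.extend]
  split_ifs <;> rfl

variable {idx} (hidx : Function.Injective idx)
include hidx

theorem treeCoordinates_pderiv (i : Fin N) (x : H) :
    treeCoordinates idx (MvPolynomial.pderiv (idx i) x) = partialDeriv i (treeCoordinates idx x) :=
  algHom_derivation_comm _ (fun s => by
    classical
    rw [MvPolynomial.pderiv_X, treeCoordinates, MvPolynomial.aeval_X]
    by_cases h : ∃ j, idx j = s
    · obtain ⟨j, rfl⟩ := h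
      rw [hidx.extend_apply, partialDeriv_coordinate, Pi.single_apply, hidx.eq_iff]
      simp only [eq_comm (a := j), apply_ite (MvPolynomial.aeval _), map_one, map_zero]
    · rw [Function.extend_apply' _ _ _ h, Pi.single_eq_of_ne fun hs => h ⟨i, hs.symm⟩]
      simp) x

open Classical in
theorem evalAt_multiDeriv_treeCoordinates {W : RTree → Fin N → smoothAlgebra N} (us : List RTree)
    (hrange : ∀ u ∈ us, ∃ i, idx i = u)
    (hW : ∀ u ∈ us, ∀ i, evalAt 0 (W u i) = if idx i = u then (u.symmetryFactor : ℝ) else 0)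
    (x : H) :
    evalAt 0 (multiDeriv partialDeriv (us.map W) (treeCoordinates idx x)) =
      counit ((us.reverse.map fun u => (dualDerivation u).toLinearMap).prod x) := by
  induction us generalizing x with
  | nil => exact evalAt_zero_treeCoordinates idx x
  | cons u us ih =>
    obtain ⟨i, rfl⟩ := hrange u List.mem_cons_self
    have hterm : ∀ i', evalAt 0 (W (idx i) i' * multiDeriv partialDeriv (us.map W)
        (partialDeriv i' (treeCoordinates idx x))) =
        if i' = i then (idx i).symmetryFactor * counit
          ((us.reverse.map fun u => (dualDerivation u).toLinearMap).prod
            (MvPolynomial.pderiv (idx i) x)) else 0 := fun i' => by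
      rw [map_mul, hW _ List.mem_cons_self, ← treeCoordinates_pderiv hidx,
        ih (fun u hu => hrange u (List.mem_cons_of_mem _ hu))
          fun u hu => hW u (List.mem_cons_of_mem _ hu)]
      simp only [hidx.eq_iff, ite_mul, zero_mul]
      split_ifs with h
      · rw [h]
      · rfl
    rw [List.map_cons, multiDeriv, map_sum, Finset.sum_congr rfl fun i' _ => hterm i',
      Finset.sum_ite_eq' _ _ _, if_pos (Finset.mem_univ i)]
    simp [dualDerivation]

open Classical in
theorem evalAt_smoothElementary_treeField {K : ℕ} (hrange : ∀ s, s.order ≤ K → ∃ i, idx i = s)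
    {t : RTree} (ht : t.order ≤ K) (j : Fin N) :
    evalAt 0 (smoothElementary (treeField idx) t j) =
      if idx j = t then (t.symmetryFactor : ℝ) else 0 := by
  induction t using RTree.ind generalizing j with
  | h us ih =>
    induction us using Quotient.inductionOn with
    | h us =>
      rw [Multiset.quot_mk_to_coe] at ih ht ⊢
      have hchild : ∀ u ∈ us, u.order ≤ K := fun u hu => by
        have := Multiset.single_le_sum (fun _ _ => Nat.zero_le _) _
          (Multiset.mem_map_of_mem RTree.order (Multiset.mem_coe.2 hu))
        rw [RTree.order_node] at ht
        lia
      have hcomp : component (treeField idx) j =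
          treeCoordinates idx (forest (idx j).children) := rfl
      have hnode : (idx j).children = us ↔ idx j = RTree.node us :=
        ⟨fun h => by rw [← h, RTree.node_children], fun h => by rw [h, RTree.children_node]⟩
      rw [smoothElementary_node, hcomp,
        evalAt_multiDeriv_treeCoordinates hidx us (fun u hu => hrange u (hchild u hu))
          fun u hu i => ih u hu (hchild u hu) i,
        counit_prod_dualDerivation, forest_eq_monomial, MvPolynomial.coeff_monomial]
      simp [Multiset.coe_reverse, hnode]

end Separation

theorem bSeries_injective : Function.Injective bSeries := by
  classical
  intro φ ψ h
  refine algHom_ext_tree fun t => ?_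
  let e := (treesLE t.order).equivFin
  let idx : Fin (treesLE t.order).card → RTree := fun i => (e.symm i).1
  have hidx : Function.Injective idx := Subtype.val_injective.comp e.symm.injective
  have hrange : ∀ s, s.order ≤ t.order → ∃ i, idx i = s := fun s hs =>
    ⟨e ⟨s, mem_treesLE.2 hs⟩, by simp [idx]⟩
  obtain ⟨j, hj⟩ := hrange t le_rfl
  have hread : ∀ χ : Character, bSeries χ _ (treeField idx) t.order 0 j = χ (tree t) := fun χ => by
    rw [bSeries, if_neg t.order_pos.ne', Finset.sum_apply, Finset.sum_eq_single t]
    · rw [Pi.smul_apply, ← smoothElementary_apply, ← evalAt_apply,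
        evalAt_smoothElementary_treeField hidx hrange le_rfl, if_pos hj, smul_eq_mul,
        div_mul_cancel₀ _ (symmetryFactor_ne_zero t)]
    · intro u hu hut
      rw [Pi.smul_apply, ← smoothElementary_apply, ← evalAt_apply,
        evalAt_smoothElementary_treeField hidx hrange (RTree.mem_ofOrder.1 hu).le,
        if_neg fun h => hut (h.symm.trans hj), smul_zero]
    · exact fun h => absurd (RTree.mem_ofOrder.2 rfl) h
  rw [← hread φ, ← hread ψ, h]

/-! ### Adjoint methods -/

section Adjoint

variable {N : ℕ}

theorem comp_right_cancel {Φ Φ' Ψ : FormalMap N} (hΨ : ∀ y, Ψ 0 y = y)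
    (h : Φ.comp Ψ = Φ'.comp Ψ) : Φ = Φ' := by
  funext n
  induction n using Nat.strong_induction_on with
  | _ n ih =>
    funext y
    have hn := congrFun (congrFun h n) y
    have hmem : (n, 0) ∈ Finset.HasAntidiagonal.antidiagonal n := by simp
    have hlower : ∑ p ∈ (Finset.HasAntidiagonal.antidiagonal n).erase (n, 0),
        FormalMap.substCoeff (Φ p.1) Ψ p.2 y =
        ∑ p ∈ (Finset.HasAntidiagonal.antidiagonal n).erase (n, 0),
        FormalMap.substCoeff (Φ' p.1) Ψ p.2 y := by
      refine Finset.sum_congr rfl fun p hp => ?_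
      obtain ⟨hne, hp⟩ := Finset.mem_erase.1 hp
      rw [Finset.HasAntidiagonal.mem_antidiagonal] at hp
      rw [ih p.1 (lt_of_le_of_ne (by lia) fun h' => hne (Prod.ext h' (by lia)))]
    rw [FormalMap.comp, FormalMap.comp, ← Finset.add_sum_erase _ _ hmem,
      ← Finset.add_sum_erase _ _ hmem, hlower, FormalMap.substCoeff_zero,
      FormalMap.substCoeff_zero, hΨ] at hn
    exact add_right_cancel hn

theorem bSeries_zero (φ : Character) (f : SmoothField N) (y : Fin N → ℝ) :
    bSeries φ N f 0 y = y :=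
  if_pos rfl

theorem neg_bSeries (ψ : Character) (f : SmoothField N) :
    (bSeries ψ N f).neg = bSeries (bar ψ) N f := by
  funext n y
  rcases eq_or_ne n 0 with rfl | hn
  · simp [FormalMap.neg, bSeries]
  · rw [FormalMap.neg, bSeries, bSeries, if_neg hn, if_neg hn, Finset.smul_sum]
    refine Finset.sum_congr rfl fun t ht => ?_
    rw [bar_tree, RTree.mem_ofOrder.1 ht, smul_smul, mul_div_assoc]

theorem bSeries_counit (f : SmoothField N) : bSeries counit N f = FormalMap.id := by
  funext n y
  simp [FormalMap.id, bSeries, counit, tree]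

theorem forall_bSeries_comp_eq_id_iff (φ₁ φ₂ : Character) :
    (∀ N f, (bSeries φ₂ N f).comp (bSeries φ₁ N f) = FormalMap.id) ↔ φ₁ * φ₂ = 1 := by
  refine ⟨fun h => bSeries_injective (funext₂ fun N f => ?_), fun h N f => ?_⟩
  · exact (bSeries_comp φ₁ φ₂ f).symm.trans ((h N f).trans (bSeries_counit f).symm)
  · exact (bSeries_comp φ₁ φ₂ f).trans ((congrArg (bSeries · N f) h).trans (bSeries_counit f))

theorem isAdjoint_bSeries_iff (ψ ψ' : Character) :
    IsAdjoint (bSeries ψ) (bSeries ψ') ↔ ψ' = (bar ψ)⁻¹ := by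
  simp only [IsAdjoint, neg_bSeries, forall_and, forall_bSeries_comp_eq_id_iff]
  refine ⟨fun h => eq_inv_of_mul_eq_one_right h.1, ?_⟩
  rintro rfl
  exact ⟨mul_inv_cancel _, inv_mul_cancel _⟩

theorem isSymmetric_bSeries_iff (ψ : Character) :
    IsSymmetric (bSeries ψ) ↔ ψ = (bar ψ)⁻¹ :=
  isAdjoint_bSeries_iff ψ ψ

theorem eq_inv_bar_iff {ψ ψ' : Character} :
    ψ' = (bar ψ)⁻¹ ↔ ∀ τ, ψ' (tree τ) = (-1 : ℝ) ^ τ.order * ψ (antipode (tree τ)) := by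
  rw [← bar_comp_antipode]
  exact ⟨fun h τ => h ▸ bar_tree _ τ, fun h =>
    algHom_ext_tree fun τ => (h τ).trans (bar_tree (ψ.comp antipode) τ).symm⟩

theorem isAdjoint_bSeries_unique {ψ : Character} {Φ Φ' : Method}
    (h : IsAdjoint (bSeries ψ) Φ) (h' : IsAdjoint (bSeries ψ) Φ') : Φ = Φ' := by
  funext N f
  refine comp_right_cancel (fun y => ?_) ((h N f).1.trans (h' N f).1.symm)
  rw [neg_bSeries, bSeries_zero]

end Adjoint

end BCK

end

theorem mainTheorem4 (ψ : BCK.Character) :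
    -- the adjoint method of the B-series method of `ψ` exists, is unique, and is a B-series method
    (∃! Φ : BCK.Method, BCK.IsAdjoint (BCK.bSeries ψ) Φ) ∧
    (∃ ψ' : BCK.Character, BCK.IsAdjoint (BCK.bSeries ψ) (BCK.bSeries ψ')) ∧
    -- its character on trees and, more generally, on all of `H`
    (∀ ψ' : BCK.Character, BCK.IsAdjoint (BCK.bSeries ψ) (BCK.bSeries ψ') →
      (∀ τ : BCK.RTree,
        ψ' (BCK.tree τ) = (-1 : ℝ) ^ τ.order * ψ (BCK.antipode (BCK.tree τ))) ∧
      ψ' = BCK.bar (ψ.comp BCK.antipode)) ∧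
    -- symmetric methods
    (BCK.IsSymmetric (BCK.bSeries ψ) ↔ BCK.IsOdd ψ) ∧
    (BCK.IsSymmetric (BCK.bSeries ψ) ↔
      ∀ τ : BCK.RTree,
        ψ (BCK.tree τ) = (-1 : ℝ) ^ τ.order * ψ (BCK.antipode (BCK.tree τ))) := by
  have hadj : BCK.IsAdjoint (BCK.bSeries ψ) (BCK.bSeries (BCK.bar ψ)⁻¹) :=
    (BCK.isAdjoint_bSeries_iff ψ _).2 rfl
  refine ⟨⟨_, hadj, fun Φ hΦ => BCK.isAdjoint_bSeries_unique hΦ hadj⟩, ⟨_, hadj⟩, ?_, ?_, ?_⟩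
  · intro ψ' h
    rw [BCK.isAdjoint_bSeries_iff] at h
    exact ⟨BCK.eq_inv_bar_iff.1 h, h.trans (BCK.bar_comp_antipode ψ).symm⟩
  · rw [BCK.isSymmetric_bSeries_iff, eq_comm, inv_eq_iff_eq_inv, BCK.isOdd_iff]
  · rw [BCK.isSymmetric_bSeries_iff, BCK.eq_inv_bar_iff]
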